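/- Let $\Sigma$ be the infinite trivalent tree dual to the Farey triangulation of the hyperbolic plane, and let $\Omega$ be the set of its complementary regions, identified with $\mathbb{Q}\cup\{\infty\}$; write $e\leftrightarrow(X,Y;Z,W)$ if $e$ is the edge $X\cap Y$ and its endpoints are $e\cap Z$ and $e\cap W$. Fix a colouring $\Omega=\Omega_1\sqcup\Omega_2\sqcup\Omega_3$ such that, for each edge $e\leftrightarrow(X,Y;Z,W)$, the regions $Z,W$ have the same colour and $X,Y,Z$ have three different colours. Let $\boldsymbol\mu=(p,q,r,s)\in\mathbb{C}^4$. A $\boldsymbol\mu$-Markoff map is a function $\phi:\Omega\to\mathbb{C}$ such that, for $X,X'\in\Omega_1$, $Y,Y'\in\Omega_2$, $Z,Z'\in\Omega_3$, with values $x,x',y,y',z,z'$ under $\phi$, (i) $x^2+y^2+z^2+xyz=px+qy+rz+s$ whenever $X,Y,Z$ meet at a vertex; (ii) $x+x'=p-yz$ for each edge $(Y,Z;X,X')$, $y+y'=q-xz$ for each edge $(X,Z;Y,Y')$, and $z+z'=r-xy$ for each edge $(X,Y;Z,Z')$. Let $\alpha=\frac12\max\{|p|,|q|,|r|\}$. Let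 $\mathcal{S}_{\boldsymbol\mu}\subset\mathbb{C}$ be the finite set of values of one coordinate for which the conic cut out by equation (i) in the other two coordinates is degenerate, for any of the three coordinates (if $p=ab+cd$, $q=bc+ad$, $r=ac+bd$, $s=4-a^2-b^2-c^2-d^2-abcd$, this is the set of roots of the polynomials $t^2-uvt+u^2+v^2-4$ for the six pairs $\{u,v\}$ from $a,b,c,d$). Let $$M=\max\left\{\left|\frac{2p_i-tp_j}{4-t^2}\right| : t\in\mathcal{S}_{\boldsymbol\mu}\setminus\{\pm2\},\ i\neq j\right\},\qquad (p_1,p_2,p_3)=(p,q,r)$$ ($M=0$ if there is no such $t$), and let $L=\max\{2+\alpha,\,m,\,M+1\}$, where $m$ is any real number, subject only to $m>2$ in the exceptional case $\boldsymbol\mu=(0,0,0,4)$. Suppose that the $\boldsymbol\mu$-Markoff map $\phi$ satisfies the BQ-conditions: (BQ1) $\phi(X)\notin[-2,2]$ for every $X\in\Omega$; (BQ2) $|\phi(X)|\le L$ for only finitely many $X\in\Omega$. Then $\log^+|\phi|=\max\{\log|\phi|,0\}$ has Fibonacci growth: for every edge $e$ of $\Sigma$ there are constants $\kappa,\kappa'>0$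 such that $$\log^+|\phi(X)|\le\kappa F_e(X)\ \text{ for all } X\in\Omega,\qquad \log^+|\phi(X)|\ge\kappa' F_e(X)\ \text{ for all but finitely many } X\in\Omega.$$ Here $F_e:\Omega\to\mathbb{N}$ is the Fibonacci function of $e$. It equals $1$ on the two regions containing $e$. Let $Z$ be any other region, and let $h$ be the endpoint of $e$ such that the boundary of $Z$ lies on the opposite side of $e$ from $h$; then $F_e(Z)=F_e(X)+F_e(Y)$, where $X,Y$ are the two regions that share an edge with $Z$, that either contain $e$ or have their boundary on the same side of $e$ as $Z$, and that are closer to $h$ than $Z$ (the distance of a region is the number of edges of a shortest path in $\Sigma$ from $h$ to it). -/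

import Mathlib

namespace MarkoffFarey

noncomputable section

/-! The trivalent plane tree `Σ` is realised as the tree dual to the Farey triangulation of the
hyperbolic plane.  Its complementary regions are indexed by `ℚ ∪ {∞}`, its edges correspond to the
Farey edges and its vertices to the Farey triangles. -/

/-- The complementary regions of the tree, labelled by their slope in `ℚ ∪ {∞}`. -/
abbrev Region : Type := OnePoint ℚ

/-- Numerator of a slope, with `∞ = 1/0`. -/
def num : Region → ℤ
  | none => 1
  | some x => x.num

/-- Denominator of a slope, with `∞ = 1/0`. -/
def den : Region → ℤ
  | none => 0
  | some x => x.den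

/-- The Farey graph: `a/b` and `c/d` (in lowest terms) are joined when `|ad - bc| = 1`.
Two regions are joined exactly when their boundaries share an edge of the tree. -/
def fareyGraph : SimpleGraph Region where
  Adj X Y := |num X * den Y - num Y * den X| = 1
  symm := ⟨fun X Y h => by rw [abs_sub_comm]; exact h⟩
  loopless := ⟨fun X h => by simp at h⟩

/-- Vertices of the tree: the Farey triangles.  `X ∈ v.1` means that the region `X` meets `v`. -/
abbrev Vertex : Type := {t : Finset Region // fareyGraph.IsNClique 3 t}

/-- The trivalent tree: two distinct Farey triangles are joined when they share a Farey edge. -/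
def tree : SimpleGraph Vertex where
  Adj v w := v ≠ w ∧ ∃ X Y : Region, X ≠ Y ∧ (X ∈ v.1 ∧ Y ∈ v.1) ∧ (X ∈ w.1 ∧ Y ∈ w.1)
  symm := ⟨fun _ _ h => ⟨h.1.symm, h.2.imp fun _ h => h.imp fun _ h => ⟨h.1, h.2.2, h.2.1⟩⟩⟩
  loopless := ⟨fun _ h => h.1 rfl⟩

/-- The regions `X`, `Y`, `Z` are the three regions meeting at some vertex. -/
def MeetAtVertex (X Y Z : Region) : Prop :=
  fareyGraph.Adj X Y ∧ fareyGraph.Adj Y Z ∧ fareyGraph.Adj X Z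

/-- `e ↔ (X, Y; Z, W)`: there is an edge `e = X ∩ Y` whose two endpoints lie on `Z` and `W`. -/
def IsEdge (X Y Z W : Region) : Prop :=
  MeetAtVertex X Y Z ∧ MeetAtVertex X Y W ∧ Z ≠ W

/-- A tri-colouring of the regions: for each edge `e ↔ (X, Y; Z, W)` the regions `Z`, `W` have the
same colour (which is then the colour of `e`), and this colour and those of `X`, `Y` are all
different.  The colours `1, 2, 3` are written `0, 1, 2`. -/
def IsTricoloring (C : Region → Fin 3) : Prop :=
  ∀ X Y Z W, IsEdge X Y Z W → C Z = C W ∧ C X ≠ C Y ∧ C X ≠ C Z ∧ C Y ≠ C Z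

/-- `(p, q, r, s)`-Markoff maps, with respect to the tri-colouring `C`. -/
structure IsMarkoffMap (C : Region → Fin 3) (p q r s : ℂ) (φ : Region → ℂ) : Prop where
  vertex : ∀ X Y Z, MeetAtVertex X Y Z → C X = 0 → C Y = 1 → C Z = 2 →
    φ X ^ 2 + φ Y ^ 2 + φ Z ^ 2 + φ X * φ Y * φ Z = p * φ X + q * φ Y + r * φ Z + s
  edge₁ : ∀ Y Z X X', IsEdge Y Z X X' → C X = 0 → C X' = 0 → C Y = 1 → C Z = 2 →
    φ X + φ X' = p - φ Y * φ Z
  edge₂ : ∀ X Z Y Y', IsEdge X Z Y Y' → C X = 0 → C Y = 1 → C Y' = 1 → C Z = 2 →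
    φ Y + φ Y' = q - φ X * φ Z
  edge₃ : ∀ X Y Z Z', IsEdge X Y Z Z' → C X = 0 → C Y = 1 → C Z = 2 → C Z' = 2 →
    φ Z + φ Z' = r - φ X * φ Y

/-! ### The constants in the BQ-conditions -/

/-- `α = max {|p|, |q|, |r|} / 2`. -/
def alpha (p q r : ℂ) : ℝ := max ‖p‖ (max ‖q‖ ‖r‖) / 2

/-- The determinant of the affine conic
`y² + x y z + z² - q y - r z + x² - p x - s = 0` in the variables `y, z`. -/
def conicDet (p q r s x : ℂ) : ℂ :=
  Matrix.det !![1, x / 2, -q / 2; x / 2, 1, -r / 2; -q / 2, -r / 2, x ^ 2 - p * x - s]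

/-- The finite set `S` of values `x` of one coordinate for which the conic cut out by the Markoff
equation in the other two coordinates is degenerate (for one of the three coordinates). -/
def degenerateSet (p q r s : ℂ) : Set ℂ :=
  {x | conicDet p q r s x = 0 ∨ conicDet q p r s x = 0 ∨ conicDet r p q s x = 0}

/-- `κ_{u,v}(x) = x² - u v x + u² + v² - 4`. -/
def kappa (u v x : ℂ) : ℂ := x ^ 2 - u * v * x + u ^ 2 + v ^ 2 - 4

/-- If `(p, q, r, s)` comes from boundary traces `(a, b, c, d)`, then `S` consists of the roots
`x_{i,j}^±` of the polynomials `κ_{i,j}` for the six pairs `{i, j}` from `{a, b, c, d}`. -/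
theorem mem_degenerateSet_iff (a b c d x : ℂ) :
    x ∈ degenerateSet (a * b + c * d) (a * d + b * c) (a * c + b * d)
        (4 - a ^ 2 - b ^ 2 - c ^ 2 - d ^ 2 - a * b * c * d) ↔
      (kappa a b x = 0 ∨ kappa c d x = 0) ∨ (kappa a d x = 0 ∨ kappa b c x = 0) ∨
        (kappa a c x = 0 ∨ kappa b d x = 0) := by
  have h4 : (-4 : ℂ) ≠ 0 := by norm_num
  have h1 : kappa a b x * kappa c d x =
      -4 * conicDet (a * b + c * d) (a * d + b * c) (a * c + b * d)
        (4 - a ^ 2 - b ^ 2 - c ^ 2 - d ^ 2 - a * b * c * d) x := by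
    simp only [kappa, conicDet, Matrix.det_fin_three, Matrix.of_apply, Matrix.cons_val]
    ring
  have h2 : kappa a d x * kappa b c x =
      -4 * conicDet (a * d + b * c) (a * b + c * d) (a * c + b * d)
        (4 - a ^ 2 - b ^ 2 - c ^ 2 - d ^ 2 - a * b * c * d) x := by
    simp only [kappa, conicDet, Matrix.det_fin_three, Matrix.of_apply, Matrix.cons_val]
    ring
  have h3 : kappa a c x * kappa b d x =
      -4 * conicDet (a * c + b * d) (a * b + c * d) (a * d + b * c)
        (4 - a ^ 2 - b ^ 2 - c ^ 2 - d ^ 2 - a * b * c * d) x := by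
    simp only [kappa, conicDet, Matrix.det_fin_three, Matrix.of_apply, Matrix.cons_val]
    ring
  simp only [degenerateSet, Set.mem_ofPred_eq]
  rw [← mul_eq_zero (a := kappa a b x), ← mul_eq_zero (a := kappa a d x),
    ← mul_eq_zero (a := kappa a c x), h1, h2, h3]
  simp only [mul_eq_zero, h4, false_or]

/-- `M`: the maximal modulus of the numbers `(2 pᵢ - x pⱼ) / (4 - x²)`, where `pᵢ`, `pⱼ` stand in
different positions in `(p, q, r)` and `x ∈ S`, `x ≠ ±2`; these are the coordinates of the centres
of the degenerate conics.  (It is `0` if there is no such `x`.) -/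
def centreBound (p q r s : ℂ) : ℝ :=
  sSup {t | ∃ x ∈ degenerateSet p q r s, x ≠ 2 ∧ x ≠ -2 ∧ ∃ i j : Fin 3, i ≠ j ∧
    t = ‖(2 * ![p, q, r] i - x * ![p, q, r] j) / (4 - x ^ 2)‖}

/-- `L = max {2 + α, m, M + 1}`. -/
def bqConstant (p q r s : ℂ) (m : ℝ) : ℝ :=
  max (2 + alpha p q r) (max m (centreBound p q r s + 1))

/-- The BQ-conditions with constant `L`. -/
structure SatisfiesBQ (L : ℝ) (φ : Region → ℂ) : Prop where
  bq1 : ∀ X, φ X ∉ ((fun t : ℝ => (t : ℂ)) '' Set.Icc (-2) 2)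
  bq2 : {X | ‖φ X‖ ≤ L}.Finite

/-! ### Fibonacci functions

An oriented edge `e⃗` is a dart of the tree, with tail `e.fst` and head `e.snd`. -/

/-- `Ω⁰(e)`: the two regions `X`, `Y` with `e = X ∩ Y`. -/
def omegaZero (e : tree.Dart) : Set Region := {X | X ∈ e.fst.1 ∧ X ∈ e.snd.1}

/-- `Ω⁻(e⃗)`: the regions whose boundary lies in the component of the tail of `e⃗` after the
interior of `e` is removed from the tree. -/
def omegaMinus (e : tree.Dart) : Set Region :=
  {X | ∀ v : Vertex, X ∈ v.1 → (tree.deleteEdges {e.edge}).Reachable e.fst v}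

/-- `Ω⁰⁻(e⃗) = Ω⁰(e) ∪ Ω⁻(e⃗)`. -/
def omegaZeroMinus (e : tree.Dart) : Set Region := omegaZero e ∪ omegaMinus e

/-- `d(X)`: the number of edges in a shortest path in the tree from the head of `e⃗` to `X`. -/
def regionDist (e : tree.Dart) (X : Region) : ℕ :=
  sInf {n | ∃ v : Vertex, X ∈ v.1 ∧ tree.dist e.snd v = n}

open Classical in
/-- `F_{e⃗}` on `Ω⁰⁻(e⃗)`: it is `1` on `Ω⁰(e)`, and for `Z ∈ Ω⁻(e⃗)` it is the sum of its values at
the regions `X ∈ Ω⁰⁻(e⃗)` that meet `Z` and satisfy `d(X) < d(Z)`; there are exactly two of them.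
(Values outside `Ω⁰⁻(e⃗)` are not used.) -/
def fibDirected (e : tree.Dart) (Z : Region) : ℕ :=
  if Z ∈ omegaZero e then 1
  else ∑ᶠ X : {X : Region // X ∈ omegaZeroMinus e ∧ fareyGraph.Adj X Z ∧
    regionDist e X < regionDist e Z}, fibDirected e X.1
termination_by regionDist e Z
decreasing_by exact X.2.2.2

open Classical in
/-- The Fibonacci function `F_e` on all regions. -/
def fib (e : tree.Dart) (X : Region) : ℕ :=
  if X ∈ omegaZeroMinus e then fibDirected e X else fibDirected e.symm X

/-- Upper Fibonacci bound on `A`, with respect to each edge. -/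
def HasUpperFibonacciBoundOn (f : Region → ℝ) (A : Set Region) : Prop :=
  ∀ e : tree.Dart, ∃ κ : ℝ, 0 < κ ∧ ∀ X ∈ A, f X ≤ κ * fib e X

/-- Lower Fibonacci bound on `A`, with respect to each edge. -/
def HasLowerFibonacciBoundOn (f : Region → ℝ) (A : Set Region) : Prop :=
  ∀ e : tree.Dart, ∃ κ : ℝ, 0 < κ ∧ {X ∈ A | ¬ κ * fib e X ≤ f X}.Finite

/-- Fibonacci growth (on the set of all regions). -/
def HasFibonacciGrowth (f : Region → ℝ) : Prop :=
  HasUpperFibonacciBoundOn f Set.univ ∧ HasLowerFibonacciBoundOn f Set.univ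

end

end MarkoffFarey

/-! A region is a primitive integer vector up to sign, and an edge is a lattice basis `P`, `Q` up to
signs, its two ends lying on the regions `P + Q` and `P - Q`. In the basis attached to an edge `e`,
the Fibonacci function is the sum of the absolute values of the two coordinates (`Frame.fib_eq`):
the recursion sums over exactly the two Farey parents of a region, because distance from the head of
`e` is counted by the subtractive Euclidean algorithm. Hence `fib e` is comparable to the `ℓ¹` norm
(`exists_fib_bounds`), and it remains to compare `log⁺ |φ|` with that norm on cones generated by
mediants.

Upper bound: the edge relation bounds `|φ(P + Q)|` by `|φ(P)| |φ(Q)|` plus lower order terms, so an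
exponential bound at the start of a cone propagates (`IsLatticeMarkoff.norm_le_exp`).

Lower bound: call a cone bad if it carries no linear lower bound. A bad cone has a bad child, so a
bad cone starts an infinite path of bad cones (`HasLinearLowerBound.exists_path`). Such a path has
two possible shapes.

If it eventually turns around a single region `X`, the values met there are a bounded periodic term
plus `A lⁿ + B l⁻ⁿ` with `|l| > 1`. If `A = 0`, the conic of `X` is degenerate and infinitely many
values have modulus at most `M + 1`, against (BQ2). So the values grow exponentially, and the cones
far along are good (`exists_hasLinearLowerBound_fan`).

Otherwise it turns both ways infinitely often, and by (BQ2) its values eventually exceed `L ≥ 2 +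
α`. A single edge with `|φ(P - Q)| ≤ |φ(P + Q)|` would then make the moduli supermultiplicative up
to a constant, and its cone good (`hasLinearLowerBound_of_outward`). So the moduli decrease forever.
Their limits force `α = 0` and limit `2`, and the discriminant of the vertex relation forces `s = 4`
(`eq_four_of_descent`). This is the exceptional case, where `L ≥ m > 2` contradicts the limit `2`.
-/

namespace MarkoffFarey

/-! ### Regions as primitive integer vectors up to sign -/

/-- The determinant of two integer vectors. -/
def det (u v : ℤ × ℤ) : ℤ := u.1 * v.2 - u.2 * v.1

/-- Two integer vectors which form a basis of the lattice. -/
def Unimod (u v : ℤ × ℤ) : Prop := |det u v| = 1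

/-- The primitive vector representing a region. -/
def vec (X : Region) : ℤ × ℤ := (num X, den X)

/-- The region represented by an integer vector. -/
noncomputable def reg (u : ℤ × ℤ) : Region :=
  if u.2 = 0 then (none : Option ℚ) else (some ((u.1 : ℚ) / u.2) : Option ℚ)

lemma adj_iff {X Y : Region} : fareyGraph.Adj X Y ↔ Unimod (vec X) (vec Y) := by
  simp only [fareyGraph, Unimod, det, vec, mul_comm (num Y)]

lemma reg_vec (X : Region) : reg (vec X) = X := by
  match X with
  | none => exact if_pos rfl
  | some x =>
    have h : (x.den : ℤ) ≠ 0 := by exact_mod_cast x.den_nz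
    exact (if_neg h).trans (congrArg some (by exact_mod_cast Rat.num_div_den x))

lemma reg_neg (u : ℤ × ℤ) : reg (-u) = reg u := by
  simp [reg]

lemma isCoprime_vec (X : Region) : IsCoprime (vec X).1 (vec X).2 := by
  match X with
  | none => exact isCoprime_one_left
  | some x =>
    rw [Int.isCoprime_iff_gcd_eq_one]
    exact x.reduced

lemma vec_reg_of_pos {u : ℤ × ℤ} (h : IsCoprime u.1 u.2) (h0 : 0 < u.2) : vec (reg u) = u := by
  have hc : Nat.Coprime u.1.natAbs u.2.natAbs := Int.isCoprime_iff_gcd_eq_one.1 h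
  have hr : reg u = some ((u.1 : ℚ) / u.2) := if_neg h0.ne'
  rw [hr]
  ext
  · exact Rat.num_div_eq_of_coprime h0 hc
  · exact Rat.den_div_eq_of_coprime h0 hc

lemma vec_reg {u : ℤ × ℤ} (h : IsCoprime u.1 u.2) : vec (reg u) = u ∨ vec (reg u) = -u := by
  rcases lt_trichotomy u.2 0 with h0 | h0 | h0
  · right
    rw [← reg_neg]
    exact vec_reg_of_pos (by simpa using h.neg_neg) (by simpa using h0)
  · have : IsUnit u.1 := isCoprime_zero_right.1 (h0 ▸ h)
    rcases Int.isUnit_iff.1 this with h1 | h1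
    · left; ext <;> simp [reg, vec, num, den, h0, h1]
    · right; ext <;> simp [reg, vec, num, den, h0, h1]
  · exact Or.inl (vec_reg_of_pos h h0)

lemma reg_eq_iff {u v : ℤ × ℤ} (hu : IsCoprime u.1 u.2) (hv : IsCoprime v.1 v.2) :
    reg u = reg v ↔ u = v ∨ u = -v := by
  constructor
  · intro h
    rcases vec_reg hu with h1 | h1 <;> rcases vec_reg hv with h2 | h2 <;> rw [h, h2] at h1
    · exact Or.inl h1.symm
    · exact Or.inr h1.symm
    · exact Or.inr (by rw [h1, neg_neg])
    · exact Or.inl (neg_injective h1.symm)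
  · rintro (rfl | rfl)
    · rfl
    · exact reg_neg v

lemma vec_injective : Function.Injective vec := fun X Y h => by
  rw [← reg_vec X, h, reg_vec]

namespace Unimod

lemma cases {u v : ℤ × ℤ} (h : Unimod u v) : det u v = 1 ∨ det u v = -1 :=
  (abs_eq zero_le_one).1 h

lemma symm {u v : ℤ × ℤ} (h : Unimod u v) : Unimod v u := by
  rw [Unimod, ← h, ← abs_neg]
  congr 1
  simp only [det]
  ring

lemma isCoprime {u v : ℤ × ℤ} (h : Unimod u v) : IsCoprime u.1 u.2 := by
  rcases h.cases with h | h
  · exact ⟨v.2, -v.1, by rw [← h, det]; ring⟩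
  · exact ⟨-v.2, v.1, by rw [← neg_neg (1 : ℤ), ← h, det]; ring⟩

lemma of_det_eq {u v u' v' : ℤ × ℤ} (h : Unimod u v) (h' : det u' v' = det u v) :
    Unimod u' v' := by
  rwa [Unimod, h']

lemma neg_left {u v : ℤ × ℤ} (h : Unimod u v) : Unimod (-u) v := by
  rw [Unimod, ← h, ← abs_neg]
  congr 1
  simp only [det, Prod.fst_neg, Prod.snd_neg]
  ring

lemma neg_right {u v : ℤ × ℤ} (h : Unimod u v) : Unimod u (-v) := h.symm.neg_left.symm

lemma left_add {u v : ℤ × ℤ} (h : Unimod u v) : Unimod u (u + v) :=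
  h.of_det_eq (by simp only [det, Prod.fst_add, Prod.snd_add]; ring)

lemma add_right {u v : ℤ × ℤ} (h : Unimod u v) : Unimod (u + v) v :=
  h.of_det_eq (by simp only [det, Prod.fst_add, Prod.snd_add]; ring)

lemma add_zsmul {u v : ℤ × ℤ} (h : Unimod u v) (n : ℤ) : Unimod u (v + n • u) :=
  h.of_det_eq (by
    simp only [det, Prod.fst_add, Prod.snd_add, Prod.smul_fst, Prod.smul_snd, smul_eq_mul]; ring)

lemma reg_vec {u v : ℤ × ℤ} (h : Unimod u v) : Unimod (vec (reg u)) (vec (reg v)) := by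
  rcases vec_reg h.isCoprime with h1 | h1 <;> rcases vec_reg h.symm.isCoprime with h2 | h2 <;>
    rw [h1, h2]
  exacts [h, h.neg_right, h.neg_left, h.neg_left.neg_right]

lemma adj {u v : ℤ × ℤ} (h : Unimod u v) : fareyGraph.Adj (reg u) (reg v) :=
  adj_iff.2 h.reg_vec

lemma of_adj {u v : ℤ × ℤ} (hu : IsCoprime u.1 u.2) (hv : IsCoprime v.1 v.2)
    (h : fareyGraph.Adj (reg u) (reg v)) : Unimod u v := by
  have := adj_iff.1 h
  rcases vec_reg hu with h1 | h1 <;> rcases vec_reg hv with h2 | h2 <;> rw [h1, h2] at this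
  · exact this
  · simpa using this.neg_right
  · simpa using this.neg_left
  · simpa using this.neg_right.neg_left

lemma meetAtVertex {u v : ℤ × ℤ} (h : Unimod u v) : MeetAtVertex (reg u) (reg v) (reg (u + v)) :=
  ⟨h.adj, h.add_right.symm.adj, h.left_add.adj⟩

lemma reg_add_ne_reg_sub {u v : ℤ × ℤ} (h : Unimod u v) : reg (u + v) ≠ reg (u - v) := by
  intro hr
  have h1 : Unimod u (u - v) := by
    simpa [sub_eq_add_neg] using h.neg_right.left_add
  rw [reg_eq_iff h.add_right.isCoprime h1.symm.isCoprime] at hr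
  have hc := h.cases
  simp only [det] at hc
  rcases hr with hr | hr
  · have e1 : v.1 = 0 := by have := congrArg Prod.fst hr; simp at this; omega
    have e2 : v.2 = 0 := by have := congrArg Prod.snd hr; simp at this; omega
    simp [e1, e2] at hc
  · have e1 : u.1 = 0 := by have := congrArg Prod.fst hr; simp at this; omega
    have e2 : u.2 = 0 := by have := congrArg Prod.snd hr; simp at this; omega
    simp [e1, e2] at hc

/-- The bridge by which the colouring and edge axioms become identities about `u + v` and `u - v`.
-/
lemma isEdge {u v : ℤ × ℤ} (h : Unimod u v) :
    IsEdge (reg u) (reg v) (reg (u + v)) (reg (u - v)) := by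
  refine ⟨h.meetAtVertex, ?_, h.reg_add_ne_reg_sub⟩
  have := h.neg_right.meetAtVertex
  rwa [reg_neg, ← sub_eq_add_neg] at this

/-- Coordinates of a vector in a unimodular basis. -/
lemma eq_smul_add_smul {u v : ℤ × ℤ} (h : Unimod u v) (z : ℤ × ℤ) :
    z = (det u v * det z v) • u + (det u v * det u z) • v := by
  have hd : det u v * det u v = 1 := by rcases h.cases with h | h <;> simp [h]
  ext
  · simp only [Prod.fst_add, Prod.smul_fst, smul_eq_mul]
    calc z.1 = (det u v * det u v) * z.1 := by rw [hd, one_mul]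
      _ = _ := by simp only [det]; ring
  · simp only [Prod.snd_add, Prod.smul_snd, smul_eq_mul]
    calc z.2 = (det u v * det u v) * z.2 := by rw [hd, one_mul]
      _ = _ := by simp only [det]; ring

/-- A vector which is unimodular with both `u` and `v` is one of `±(u + v)`, `±(u - v)`. -/
lemma third {u v z : ℤ × ℤ} (h : Unimod u v) (hu : Unimod u z) (hv : Unimod v z) :
    (z = u + v ∨ z = -(u + v)) ∨ (z = u - v ∨ z = -(u - v)) := by
  have hz := h.eq_smul_add_smul z
  have e : det z v = - det v z := by simp only [det]; ring
  rw [e] at hz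
  rcases h.cases with h1 | h1 <;> rcases hu.cases with h2 | h2 <;> rcases hv.cases with h3 | h3 <;>
    rw [h1, h2, h3] at hz <;> simp at hz <;> subst hz
  · right; right; abel
  · left; left; abel
  · left; right; abel
  · right; left; abel
  · right; left; abel
  · left; right; abel
  · left; left; abel
  · right; right; abel

end Unimod

/-! ### Cones of mediants -/

/-- The primitive vectors in the cone spanned by `P` and `Q`, generated by mediants. -/
inductive Cone : ℤ × ℤ → ℤ × ℤ → ℤ × ℤ → Prop
  | left (P Q) : Cone P Q P
  | right (P Q) : Cone P Q Q
  | lower {P Q u} : Cone P (P + Q) u → Cone P Q u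
  | upper {P Q u} : Cone (P + Q) Q u → Cone P Q u

lemma Cone.symm {P Q u : ℤ × ℤ} (h : Cone P Q u) : Cone Q P u := by
  induction h with
  | left P Q => exact .right _ _
  | right P Q => exact .left _ _
  | lower _ ih => exact .upper (by rwa [add_comm])
  | upper _ ih => exact .lower (by rwa [add_comm])

/-- The subtractive Euclidean algorithm: subtracting the smaller coefficient from the larger
replaces one generator by the mediant `P + Q`. -/
lemma cone_of_coprime {a b : ℕ} (h : a.Coprime b) (P Q : ℤ × ℤ) :
    Cone P Q ((a : ℤ) • P + (b : ℤ) • Q) := by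
  induction hn : a + b using Nat.strong_induction_on generalizing a b P Q with
  | _ n ih =>
    rcases Nat.eq_zero_or_pos a with rfl | ha
    · have : b = 1 := by simpa using h
      subst this
      simpa using Cone.right P Q
    rcases Nat.eq_zero_or_pos b with rfl | hb
    · have : a = 1 := by simpa using h
      subst this
      simpa using Cone.left P Q
    rcases le_total a b with hab | hab
    · obtain ⟨c, rfl⟩ := Nat.exists_eq_add_of_le hab
      have := ih (a + c) (by omega) (a := a) (b := c) (by simpa using h) (P + Q) Q rfl
      refine .upper ?_
      convert this using 1
      push_cast
      rw [smul_add, add_smul]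
      abel
    · obtain ⟨c, rfl⟩ := Nat.exists_eq_add_of_le hab
      have := ih (c + b) (by omega) (a := c) (b := b) (by simpa using h) P (P + Q) rfl
      refine .lower ?_
      convert this using 1
      push_cast
      rw [smul_add, add_smul]
      abel

/-- Every region lies in one of the two standard cones. -/
lemma cone_vec (X : Region) :
    Cone (1, 0) (0, 1) (vec X) ∨ Cone (0, 1) (-1, 0) (vec X) := by
  have hc : Nat.Coprime (vec X).1.natAbs (vec X).2.natAbs :=
    Int.isCoprime_iff_gcd_eq_one.1 (isCoprime_vec X)
  have h2 : 0 ≤ (vec X).2 := by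
    match X with
    | none => exact le_rfl
    | some x => exact Int.natCast_nonneg _
  rcases le_total 0 (vec X).1 with h1 | h1
  · left
    convert cone_of_coprime hc (1, 0) (0, 1) using 1
    ext <;> simp [abs_of_nonneg, h1, h2]
  · right
    convert cone_of_coprime hc.symm (0, 1) (-1, 0) using 1
    ext <;> simp [abs_of_nonneg, abs_of_nonpos, h1, h2]


/-! ### Euclidean depth -/

/-- The number of steps of the subtractive Euclidean algorithm. -/
def euclidDepth : ℕ → ℕ → ℕ
  | 0, _ => 0
  | _ + 1, 0 => 0
  | a + 1, b + 1 => if a ≤ b then euclidDepth (a + 1) (b - a) + 1 else euclidDepth (a - b) (b + 1) + 1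
termination_by a b => a + b

lemma euclidDepth_zero_left (b : ℕ) : euclidDepth 0 b = 0 := by rw [euclidDepth]

lemma euclidDepth_zero_right (a : ℕ) : euclidDepth a 0 = 0 := by
  cases a <;> rw [euclidDepth]

lemma euclidDepth_add_right {a : ℕ} (b : ℕ) (ha : 0 < a) :
    euclidDepth a (a + b) = euclidDepth a b + 1 := by
  obtain ⟨a, rfl⟩ := Nat.exists_eq_succ_of_ne_zero ha.ne'
  rw [show a.succ + b = (a + b) + 1 by omega, euclidDepth, if_pos (by omega)]
  congr 2
  omega

lemma euclidDepth_add_left {b : ℕ} (a : ℕ) (hb : 0 < b) :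
    euclidDepth (a + b) b = euclidDepth a b + 1 := by
  obtain ⟨b, rfl⟩ := Nat.exists_eq_succ_of_ne_zero hb.ne'
  rcases Nat.eq_zero_or_pos a with rfl | ha
  · rw [zero_add, euclidDepth_zero_left]
    have := euclidDepth_add_right (a := b.succ) 0 hb
    rwa [add_zero, euclidDepth_zero_right] at this
  · rw [show a + b.succ = (a + b) + 1 by omega, euclidDepth, if_neg (by omega)]
    congr 2
    omega

/-- `(a, b)` and `(c, d)` form a basis of the integer lattice. -/
def NatUnimod (a b c d : ℕ) : Prop := a * d = b * c + 1 ∨ b * c = a * d + 1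

namespace NatUnimod

variable {a b c d : ℕ}

lemma symm (h : NatUnimod a b c d) : NatUnimod c d a b := by
  unfold NatUnimod at *
  rw [mul_comm c b, mul_comm d a]
  exact h.symm

lemma swap (h : NatUnimod a b c d) : NatUnimod b a d c := by
  unfold NatUnimod at *
  exact h.symm

lemma of_add (h : NatUnimod a b (a + c) (b + d)) : NatUnimod a b c d := by
  unfold NatUnimod at *
  rw [mul_add, mul_add, mul_comm b a] at h
  omega

lemma shear (h : NatUnimod a b c d) : NatUnimod a (a + b) c (c + d) := by
  unfold NatUnimod at *
  rw [mul_add, add_mul]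
  omega

lemma of_shear (h : NatUnimod a (a + b) c (c + d)) : NatUnimod a b c d := by
  unfold NatUnimod at *
  rw [mul_add, add_mul] at h
  omega

/-- Two basis vectors in the positive quadrant are comparable, unless they are the standard ones. -/
lemma comparable (h : NatUnimod a b c d) :
    (a ≤ c ∧ b ≤ d) ∨ (c ≤ a ∧ d ≤ b) ∨ (a = 1 ∧ b = 0 ∧ c = 0 ∧ d = 1) ∨
      (a = 0 ∧ b = 1 ∧ c = 1 ∧ d = 0) := by
  unfold NatUnimod at h
  by_contra! hn
  obtain ⟨h1, h2, h3, h4⟩ := hn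
  rcases le_or_gt a c with hac | hac
  · have hbd := h1 hac
    rcases hac.eq_or_lt with rfl | hac
    · have := h2 le_rfl
      omega
    obtain ⟨i, rfl⟩ := Nat.exists_eq_add_of_lt hac
    obtain ⟨j, rfl⟩ := Nat.exists_eq_add_of_lt hbd
    have e : (d + j + 1) * (a + i + 1) = a * d + (d + a + 1) + d * i + j * a + j * i + j + i := by
      ring
    rcases h with h | h
    · omega
    · have : a = 0 ∧ d = 0 ∧ i = 0 ∧ j = 0 := by omega
      omega
  · have hbd := h2 hac.le
    obtain ⟨i, rfl⟩ := Nat.exists_eq_add_of_lt hac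
    obtain ⟨j, rfl⟩ := Nat.exists_eq_add_of_lt hbd
    have e : (c + i + 1) * (b + j + 1) = b * c + (c + b + 1) + c * j + i * b + i * j + j + i := by
      ring
    rcases h with h | h
    · have : b = 0 ∧ c = 0 ∧ i = 0 ∧ j = 0 := by omega
      omega
    · omega

end NatUnimod

lemma euclidDepth_comm (a b : ℕ) : euclidDepth a b = euclidDepth b a := by
  induction hn : a + b using Nat.strong_induction_on generalizing a b with
  | _ n ih =>
    rcases Nat.eq_zero_or_pos a with rfl | ha
    · rw [euclidDepth_zero_left, euclidDepth_zero_right]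
    rcases Nat.eq_zero_or_pos b with rfl | hb
    · rw [euclidDepth_zero_left, euclidDepth_zero_right]
    rcases le_total a b with hab | hab
    · obtain ⟨c, rfl⟩ := Nat.exists_eq_add_of_le hab
      rw [euclidDepth_add_right c ha, add_comm a c, euclidDepth_add_left c ha,
        ih (a + c) (by omega) a c rfl]
    · obtain ⟨c, rfl⟩ := Nat.exists_eq_add_of_le hab
      rw [euclidDepth_add_right c hb, add_comm b c, euclidDepth_add_left c hb,
        ih (c + b) (by omega) c b rfl]

/-- If both vectors lie weakly on one side of the diagonal, one Euclidean step acts on them and on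
their sum by the same shear, and induction applies. Unimodularity leaves only the standard basis
strictly astride the diagonal. This makes the depth of a mediant one more than that of its deeper
parent, as for distances in the tree. -/
lemma NatUnimod.euclidDepth_add {a b c d : ℕ} (h : NatUnimod a b c d) :
    euclidDepth (a + c) (b + d) = max (euclidDepth a b) (euclidDepth c d) + 1 := by
  induction hn : a + b + (c + d) using Nat.strong_induction_on generalizing a b c d with
  | _ n ih =>
    -- it suffices to treat the case where both vectors lie on one side of the diagonal
    have key : ∀ a b c d : ℕ, NatUnimod a b c d → a + b + (c + d) = n → a ≤ b → c ≤ d →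
        euclidDepth (a + c) (b + d) = max (euclidDepth a b) (euclidDepth c d) + 1 := by
      intro a b c d h hn hab hcd
      obtain ⟨i, rfl⟩ := Nat.exists_eq_add_of_le hab
      obtain ⟨j, rfl⟩ := Nat.exists_eq_add_of_le hcd
      have hac : 0 < a + c := by
        by_contra h0
        have : a = 0 ∧ c = 0 := by omega
        simp [NatUnimod, this.1, this.2] at h
      have hu := h.of_shear
      have hi := ih (a + i + (c + j)) (by omega) hu rfl
      rw [show a + i + (c + j) = (a + c) + (i + j) by omega, euclidDepth_add_right _ hac, hi]
      -- A vector with zero first coordinate is fixed by the shear and has depth zero, so it does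
      -- not lose a step.
      rcases Nat.eq_zero_or_pos a with rfl | ha
      · rw [euclidDepth_zero_left, euclidDepth_zero_left,
          euclidDepth_add_right _ (by omega : 0 < c)]
        omega
      rcases Nat.eq_zero_or_pos c with rfl | hc
      · rw [euclidDepth_zero_left, euclidDepth_zero_left, euclidDepth_add_right _ ha]
        omega
      rw [euclidDepth_add_right _ ha, euclidDepth_add_right _ hc]
      omega
    have main : ∀ a b c d : ℕ, NatUnimod a b c d → a + b + (c + d) = n → a ≤ b →
        euclidDepth (a + c) (b + d) = max (euclidDepth a b) (euclidDepth c d) + 1 := by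
      intro a b c d h hn hab
      rcases le_or_gt c d with hcd | hcd
      · exact key a b c d h hn hab hcd
      · rcases hab.eq_or_lt with rfl | hab
        · rw [euclidDepth_comm (a + c), key a a d c h.swap (by omega) le_rfl hcd.le,
            euclidDepth_comm c]
        · unfold NatUnimod at h
          obtain ⟨i, rfl⟩ := Nat.exists_eq_add_of_lt hab
          obtain ⟨j, rfl⟩ := Nat.exists_eq_add_of_lt hcd
          have e : (a + i + 1) * (d + j + 1) =
              a * d + (a + d + 1) + a * j + i * d + i * j + j + i := by ring
          obtain ⟨rfl, rfl, rfl, rfl⟩ : a = 0 ∧ d = 0 ∧ i = 0 ∧ j = 0 := by omega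
          simpa [euclidDepth_zero_left, euclidDepth_zero_right] using
            euclidDepth_add_right (a := 1) 0 one_pos
    rcases le_total a b with hab | hab
    · exact main a b c d h hn hab
    · rw [euclidDepth_comm (a + c), main b a d c h.swap (by omega) hab, euclidDepth_comm b,
        euclidDepth_comm d]


/-! ### Coordinates of regions relative to an edge -/

section Frame

variable {x y : ℤ × ℤ}

/-- Vectors with natural coordinates in the basis `x`, `y`. -/
def comb (x y : ℤ × ℤ) (a b : ℕ) : ℤ × ℤ := (a : ℤ) • x + (b : ℤ) • y

lemma comb_add (x y : ℤ × ℤ) (a b c d : ℕ) :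
    comb x y (a + c) (b + d) = comb x y a b + comb x y c d := by
  simp only [comb, Nat.cast_add, add_smul]
  abel

lemma det_comb_comb (hxy : det x y = 1) (a b c d : ℕ) :
    det (comb x y a b) (comb x y c d) = a * d - b * c := by
  rw [← mul_one ((a : ℤ) * d - b * c), ← hxy]
  simp only [det, comb, Prod.fst_add, Prod.snd_add, Prod.smul_fst, Prod.smul_snd, smul_eq_mul]
  ring

lemma det_comb_right (hxy : det x y = 1) (a b : ℕ) : det (comb x y a b) y = a := by
  rw [← mul_one (a : ℤ), ← hxy]
  simp only [det, comb, Prod.fst_add, Prod.snd_add, Prod.smul_fst, Prod.smul_snd, smul_eq_mul]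
  ring

lemma det_left_comb (hxy : det x y = 1) (a b : ℕ) : det x (comb x y a b) = b := by
  rw [← mul_one (b : ℤ), ← hxy]
  simp only [det, comb, Prod.fst_add, Prod.snd_add, Prod.smul_fst, Prod.smul_snd, smul_eq_mul]
  ring

lemma natUnimod_iff (hxy : det x y = 1) {a b c d : ℕ} :
    NatUnimod a b c d ↔ Unimod (comb x y a b) (comb x y c d) := by
  rw [Unimod, det_comb_comb hxy, abs_eq zero_le_one, NatUnimod]
  zify
  constructor <;> rintro (h | h)
  · left; linarith
  · right; linarith
  · left; linarith
  · right; linarith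

/-- The product of the coordinates of a region: positive on one side of the edge `reg x ∩ reg y`,
negative on the other, and zero on the two regions containing the edge. -/
def side (x y : ℤ × ℤ) (X : Region) : ℤ := det (vec X) y * det x (vec X)

lemma det_neg_left (u v : ℤ × ℤ) : det (-u) v = - det u v := by
  simp only [det, Prod.fst_neg, Prod.snd_neg]; ring

lemma det_neg_right (u v : ℤ × ℤ) : det u (-v) = - det u v := by
  simp only [det, Prod.fst_neg, Prod.snd_neg]; ring

lemma det_swap (u v : ℤ × ℤ) : det u v = - det v u := by
  simp only [det]; ring

lemma side_reg {u : ℤ × ℤ} (hu : IsCoprime u.1 u.2) :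
    side x y (reg u) = det u y * det x u := by
  rcases vec_reg hu with h | h <;> simp [side, h, det_neg_left, det_neg_right]

lemma exists_comb_of_side_nonneg (hxy : det x y = 1) {X : Region} (h : 0 ≤ side x y X) :
    ∃ a b : ℕ, IsCoprime (comb x y a b).1 (comb x y a b).2 ∧ reg (comb x y a b) = X := by
  have hz := (show Unimod x y by simp [Unimod, hxy]).eq_smul_add_smul (vec X)
  rw [hxy, one_mul, one_mul] at hz
  have hc : comb x y (det (vec X) y).natAbs (det x (vec X)).natAbs = vec X ∨
      comb x y (det (vec X) y).natAbs (det x (vec X)).natAbs = - vec X := by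
    rcases mul_nonneg_iff.1 h with ⟨h1, h2⟩ | ⟨h1, h2⟩
    · left
      rw [comb, Int.natAbs_of_nonneg h1, Int.natAbs_of_nonneg h2, ← hz]
    · right
      rw [comb, Int.ofNat_natAbs_of_nonpos h1, Int.ofNat_natAbs_of_nonpos h2, neg_smul, neg_smul,
        ← neg_add, ← hz]
  refine ⟨(det (vec X) y).natAbs, (det x (vec X)).natAbs, ?_, ?_⟩
  · rcases hc with hc | hc <;> rw [hc]
    · exact isCoprime_vec X
    · exact (isCoprime_vec X).neg_neg
  · rcases hc with hc | hc <;> rw [hc]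
    · exact reg_vec X
    · rw [reg_neg, reg_vec]

lemma side_comb (hxy : det x y = 1) {a b : ℕ}
    (h : IsCoprime (comb x y a b).1 (comb x y a b).2) : side x y (reg (comb x y a b)) = a * b := by
  rw [side_reg h, det_comb_right hxy, det_left_comb hxy]

/-- For vectors strictly inside opposite quadrants, the two terms of the determinant in coordinates
are nonzero integers contributing with the same sign, so its modulus is at least `2`. Thus Farey
neighbours never lie strictly on opposite sides of an edge. -/
lemma side_nonneg_of_adj {X Y : Region} (hxy : det x y = 1) (h : fareyGraph.Adj X Y)
    (hX : 0 < side x y X) : 0 ≤ side x y Y := by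
  have hu := (adj_iff.1 h).cases
  by_contra! hY
  have e : det (vec X) (vec Y) =
      det (vec X) y * det x (vec Y) - det x (vec X) * det (vec Y) y := by
    rw [← mul_one (det (vec X) (vec Y)), ← hxy]
    simp only [det]; ring
  rw [e] at hu
  simp only [side] at hX hY
  rcases pos_and_pos_or_neg_and_neg_of_mul_pos hX with ⟨h1, h2⟩ | ⟨h1, h2⟩ <;>
    rcases mul_neg_iff.1 hY with ⟨h3, h4⟩ | ⟨h3, h4⟩
  · have a1 := mul_neg_of_pos_of_neg h1 h4
    have a2 := mul_pos h2 h3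
    omega
  · have a1 := mul_pos h1 h4
    have a2 := mul_neg_of_pos_of_neg h2 h3
    omega
  · have a1 := mul_pos_of_neg_of_neg h1 h4
    have a2 := mul_neg_of_neg_of_pos h2 h3
    omega
  · have a1 := mul_neg_of_neg_of_pos h1 h4
    have a2 := mul_pos_of_neg_of_neg h2 h3
    omega

lemma side_swap (X : Region) : side (-y) x X = - side x y X := by
  simp only [side, det_neg_left, det_swap (vec X) y, det_swap (vec X) x]; ring

lemma side_nonpos_of_adj {X Y : Region} (hxy : det x y = 1) (h : fareyGraph.Adj X Y)
    (hX : side x y X < 0) : side x y Y ≤ 0 := by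
  have := side_nonneg_of_adj (x := -y) (y := x) (by rw [det_neg_left, det_swap, neg_neg, hxy]) h
    (by rw [side_swap]; omega)
  rw [side_swap] at this
  omega

/-- One coordinate vanishes, and primitivity makes the other a unit. -/
lemma eq_of_side_eq_zero (hxy : det x y = 1) {X : Region} (h : side x y X = 0) :
    X = reg x ∨ X = reg y := by
  have hu : Unimod x y := by simp [Unimod, hxy]
  obtain ⟨a, b, hc, rfl⟩ := exists_comb_of_side_nonneg hxy h.ge
  rw [side_comb hxy hc] at h
  rcases mul_eq_zero.1 h with h | h
  · right
    have h0 : a = 0 := by exact_mod_cast h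
    subst h0
    have hy : comb x y 0 b = (b : ℤ) • y := by simp [comb]
    rw [hy] at hc ⊢
    have hb : IsUnit (b : ℤ) := by
      refine hc.isUnit_of_dvd' ?_ ?_ <;> simp
    rcases Int.isUnit_iff.1 hb with h1 | h1
    · rw [h1, one_smul]
    · rw [h1, neg_smul, one_smul, reg_neg]
  · left
    have h0 : b = 0 := by exact_mod_cast h
    subst h0
    have hy : comb x y a 0 = (a : ℤ) • x := by simp [comb]
    rw [hy] at hc ⊢
    have hb : IsUnit (a : ℤ) := by
      refine hc.isUnit_of_dvd' ?_ ?_ <;> simp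
    rcases Int.isUnit_iff.1 hb with h1 | h1
    · rw [h1, one_smul]
    · rw [h1, neg_smul, one_smul, reg_neg]

lemma side_left (hxy : det x y = 1) : side x y (reg x) = 0 := by
  rw [side_reg (show Unimod x y by simp [Unimod, hxy]).isCoprime]
  simp [det, mul_comm]

lemma side_right (hxy : det x y = 1) : side x y (reg y) = 0 := by
  rw [side_reg (show Unimod x y by simp [Unimod, hxy]).symm.isCoprime]
  simp [det, mul_comm]

lemma side_add (hxy : det x y = 1) : side x y (reg (x + y)) = 1 := by
  have := (show Unimod x y by simp [Unimod, hxy]).add_right.isCoprime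
  have e : x + y = comb x y 1 1 := by simp [comb]
  rw [e] at this ⊢
  rw [side_comb hxy this]
  rfl

lemma side_sub (hxy : det x y = 1) : side x y (reg (x - y)) = -1 := by
  have h1 : det (-y) x = 1 := by rw [det_neg_left, det_swap, neg_neg, hxy]
  have := side_add h1
  rw [side_swap, show -y + x = x - y by abel] at this
  omega

/-- The depth of a region in the half of the tree where `side` is nonnegative. -/
def depth (x y : ℤ × ℤ) (X : Region) : ℕ :=
  if 0 ≤ side x y X then euclidDepth (det (vec X) y).natAbs (det x (vec X)).natAbs else 0

lemma depth_comb (hxy : det x y = 1) {a b : ℕ}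
    (h : IsCoprime (comb x y a b).1 (comb x y a b).2) :
    depth x y (reg (comb x y a b)) = euclidDepth a b := by
  rw [depth, side_comb hxy h, if_pos (by positivity)]
  rcases vec_reg h with h | h <;>
    simp [h, det_neg_left, det_neg_right, det_comb_right hxy, det_left_comb hxy]

lemma depth_eq_zero {X : Region} (h : side x y X ≤ 0) : depth x y X = 0 := by
  rcases h.lt_or_eq with h | h
  · rw [depth, if_neg h.not_ge]
  · rw [depth, if_pos h.ge]
    rcases mul_eq_zero.1 h with h | h <;> rw [h]
    · exact euclidDepth_zero_left _
    · exact euclidDepth_zero_right _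

/-- Three pairwise adjacent regions on the nonnegative side are `P`, `Q`, `P + Q` in some order. -/
lemma exists_comb_of_meetAtVertex (hxy : det x y = 1) {X Y Z : Region} (h : MeetAtVertex X Y Z)
    (hX : 0 ≤ side x y X) (hY : 0 ≤ side x y Y) (hZ : 0 ≤ side x y Z) :
    ∃ a b c d : ℕ, NatUnimod a b c d ∧
      (({X, Y, Z} : Set Region) =
        {reg (comb x y a b), reg (comb x y c d), reg (comb x y (a + c) (b + d))}) ∧
      (Z = reg (comb x y a b) ∨ Z = reg (comb x y c d) ∨
        Z = reg (comb x y (a + c) (b + d))) := by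
  obtain ⟨a, b, hc1, rfl⟩ := exists_comb_of_side_nonneg hxy hX
  obtain ⟨c, d, hc2, rfl⟩ := exists_comb_of_side_nonneg hxy hY
  obtain ⟨m, n, hc3, rfl⟩ := exists_comb_of_side_nonneg hxy hZ
  obtain ⟨h1, h2, h3⟩ := h
  have u1 := Unimod.of_adj hc1 hc2 h1
  have u2 := Unimod.of_adj hc2 hc3 h2
  have u3 := Unimod.of_adj hc1 hc3 h3
  rcases u1.third u3 u2 with (h | h) | (h | h)
  · refine ⟨a, b, c, d, (natUnimod_iff hxy).2 u1, ?_, ?_⟩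
    · rw [comb_add, ← h]
    · rw [comb_add, ← h]; simp
  · refine ⟨a, b, c, d, (natUnimod_iff hxy).2 u1, ?_, ?_⟩
    · rw [comb_add, ← reg_neg (comb x y a b + comb x y c d), ← h]
    · rw [comb_add, ← reg_neg (comb x y a b + comb x y c d), ← h]; simp
  · have e : comb x y a b = comb x y (m + c) (n + d) := by rw [comb_add, h]; abel
    refine ⟨m, n, c, d, (natUnimod_iff hxy).2 u2.symm, ?_, Or.inl rfl⟩
    rw [← e]
    ext; simp only [Set.mem_insert_iff, Set.mem_singleton_iff]; tauto
  · have e : comb x y c d = comb x y (a + m) (b + n) := by rw [comb_add, h]; abel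
    refine ⟨a, b, m, n, (natUnimod_iff hxy).2 u3, ?_, Or.inr (Or.inl rfl)⟩
    rw [← e]
    ext; simp only [Set.mem_insert_iff, Set.mem_singleton_iff]; tauto

/-- Depth is subadditive up to one along an edge of the tree. -/
lemma depth_third_le (hxy : det x y = 1) {X Y Z : Region} (h : MeetAtVertex X Y Z) :
    depth x y Z ≤ max (depth x y X) (depth x y Y) + 1 := by
  rcases le_or_gt (side x y Z) 0 with hZ | hZ
  · rw [depth_eq_zero hZ]
    exact Nat.zero_le _
  have hX := side_nonneg_of_adj hxy h.2.2.symm hZ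
  have hY := side_nonneg_of_adj hxy h.2.1.symm hZ
  obtain ⟨a, b, c, d, hn, hs, hz⟩ := exists_comb_of_meetAtVertex hxy h hX hY hZ.le
  have hu := (natUnimod_iff hxy).1 hn
  have hu1 := hu.add_right.isCoprime
  rw [← comb_add] at hu1
  have e1 := depth_comb hxy hu.isCoprime
  have e2 := depth_comb hxy hu.symm.isCoprime
  have e3 := depth_comb hxy hu1
  have hd := hn.euclidDepth_add
  rcases hz with rfl | rfl | rfl
  · have : reg (comb x y (a + c) (b + d)) ∈ ({X, Y, reg (comb x y a b)} : Set Region) := by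
      rw [hs]; simp
    simp only [Set.mem_insert_iff, Set.mem_singleton_iff] at this
    rcases this with h' | h' | h' <;> rw [h'] at e3 <;> omega
  · have : reg (comb x y (a + c) (b + d)) ∈ ({X, Y, reg (comb x y c d)} : Set Region) := by
      rw [hs]; simp
    simp only [Set.mem_insert_iff, Set.mem_singleton_iff] at this
    rcases this with h' | h' | h' <;> rw [h'] at e3 <;> omega
  · have hP : reg (comb x y a b) ∈ ({X, Y, reg (comb x y (a + c) (b + d))} : Set Region) := by
      rw [hs]; simp
    have hQ : reg (comb x y c d) ∈ ({X, Y, reg (comb x y (a + c) (b + d))} : Set Region) := by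
      rw [hs]; simp
    simp only [Set.mem_insert_iff, Set.mem_singleton_iff] at hP hQ
    rcases hP with h' | h' | h' <;> rw [h'] at e1 <;> rcases hQ with h'' | h'' | h'' <;>
      rw [h''] at e2 <;> omega

end Frame


/-! ### Vertices, oriented edges and distances in the tree -/

lemma vertex_ext {t t' : Vertex} (h : ∀ W, W ∈ t.1 ↔ W ∈ t'.1) : t = t' :=
  Subtype.ext (Finset.ext h)

lemma exists_meetAtVertex (t : Vertex) :
    ∃ X Y Z, MeetAtVertex X Y Z ∧ ∀ W, W ∈ t.1 ↔ W = X ∨ W = Y ∨ W = Z := by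
  classical
  obtain ⟨X, Y, Z, h1, h2, h3, h⟩ := SimpleGraph.is3Clique_iff.1 t.2
  exact ⟨X, Y, Z, ⟨h1, h3, h2⟩, fun W => by rw [h]; simp⟩

lemma exists_third {t : Vertex} {X Y : Region} (hX : X ∈ t.1) (hY : Y ∈ t.1) (hXY : X ≠ Y) :
    ∃ Z, MeetAtVertex X Y Z ∧ ∀ W, W ∈ t.1 ↔ W = X ∨ W = Y ∨ W = Z := by
  obtain ⟨A, B, C, ⟨h1, h2, h3⟩, h⟩ := exists_meetAtVertex t
  rcases (h X).1 hX with rfl | rfl | rfl <;> rcases (h Y).1 hY with rfl | rfl | rfl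
  · exact absurd rfl hXY
  · exact ⟨C, ⟨h1, h2, h3⟩, h⟩
  · exact ⟨B, ⟨h3, h2.symm, h1⟩, fun W => by rw [h]; tauto⟩
  · exact ⟨C, ⟨h1.symm, h3, h2⟩, fun W => by rw [h]; tauto⟩
  · exact absurd rfl hXY
  · exact ⟨A, ⟨h2, h3.symm, h1.symm⟩, fun W => by rw [h]; tauto⟩
  · exact ⟨B, ⟨h3.symm, h1, h2.symm⟩, fun W => by rw [h]; tauto⟩
  · exact ⟨A, ⟨h2.symm, h1.symm, h3.symm⟩, fun W => by rw [h]; tauto⟩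
  · exact absurd rfl hXY

open Classical in
/-- The vertex of the tree at which `reg P`, `reg Q` and `reg (P + Q)` meet. -/
noncomputable def tri (P Q : ℤ × ℤ) (h : Unimod P Q) : Vertex :=
  ⟨{reg P, reg Q, reg (P + Q)}, SimpleGraph.is3Clique_triple_iff.2
    ⟨h.adj, h.left_add.adj, h.add_right.symm.adj⟩⟩

lemma mem_tri {P Q : ℤ × ℤ} (h : Unimod P Q) (W : Region) :
    W ∈ (tri P Q h).1 ↔ W = reg P ∨ W = reg Q ∨ W = reg (P + Q) := by
  simp [tri]

lemma exists_vertex (X : Region) : ∃ t : Vertex, X ∈ t.1 := by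
  obtain ⟨a, b, h⟩ := isCoprime_vec X
  have : Unimod (vec X) (-b, a) := by
    rw [Unimod, det, show (vec X).1 * a - (vec X).2 * -b = a * (vec X).1 + b * (vec X).2 by ring, h]
    simp
  exact ⟨tri _ _ this, (mem_tri this X).2 (Or.inl (reg_vec X).symm)⟩

/-- A basis of the lattice adapted to an oriented edge. -/
structure Frame (e : tree.Dart) (x y : ℤ × ℤ) : Prop where
  det_eq : det x y = 1
  mem_fst : ∀ W, W ∈ e.fst.1 ↔ W = reg x ∨ W = reg y ∨ W = reg (x + y)
  mem_snd : ∀ W, W ∈ e.snd.1 ↔ W = reg x ∨ W = reg y ∨ W = reg (x - y)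

lemma reg_sub_comm (x y : ℤ × ℤ) : reg (x - y) = reg (y - x) := by
  rw [← reg_neg, neg_sub]

lemma exists_frame (e : tree.Dart) : ∃ x y, Frame e x y := by
  obtain ⟨hne, X, Y, hXY, ⟨hX1, hY1⟩, hX2, hY2⟩ := e.adj
  obtain ⟨Z, hZ, hZm⟩ := exists_third hX1 hY1 hXY
  obtain ⟨W, hW, hWm⟩ := exists_third hX2 hY2 hXY
  have hZW : Z ≠ W := fun h => hne (vertex_ext fun V => by rw [hZm, hWm, h])
  have hu := adj_iff.1 hZ.1
  have third : ∀ {V}, MeetAtVertex X Y V →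
      V = reg (vec X + vec Y) ∨ V = reg (vec X - vec Y) := by
    intro V hV
    rw [← reg_vec V]
    rcases hu.third (adj_iff.1 hV.2.2) (adj_iff.1 hV.2.1) with (h | h) | (h | h)
    · exact Or.inl (by rw [h])
    · exact Or.inl (by rw [h, reg_neg])
    · exact Or.inr (by rw [h])
    · exact Or.inr (by rw [h, reg_neg])
  -- Changing the sign of one basis vector exchanges sum and difference, which puts the sum at the
  -- tail. Exchanging the vectors afterwards corrects the sign of the determinant without moving
  -- either end.
  have main : ∃ x y, Unimod x y ∧ reg x = X ∧ reg y = Y ∧ reg (x + y) = Z ∧ reg (x - y) = W := by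
    rcases third hZ with h1 | h1 <;> rcases third hW with h2 | h2
    · exact absurd (h1.trans h2.symm) hZW
    · exact ⟨_, _, hu, reg_vec X, reg_vec Y, h1.symm, h2.symm⟩
    · exact ⟨_, _, hu.neg_right, reg_vec X, by rw [reg_neg, reg_vec],
        by rw [h1, sub_eq_add_neg], by rw [h2, sub_neg_eq_add]⟩
    · exact absurd (h1.trans h2.symm) hZW
  obtain ⟨x, y, hxy, rfl, rfl, rfl, rfl⟩ := main
  rcases hxy.cases with h | h
  · exact ⟨x, y, h, hZm, hWm⟩
  · refine ⟨y, x, by rw [det_swap, h, neg_neg], fun W => ?_, fun W => ?_⟩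
    · rw [hZm, add_comm]; tauto
    · rw [hWm, reg_sub_comm]; tauto

namespace Frame

variable {e : tree.Dart} {x y : ℤ × ℤ}

lemma unimod (F : Frame e x y) : Unimod x y := by simp [Unimod, F.det_eq]

lemma symm (F : Frame e x y) : Frame e.symm (-y) x where
  det_eq := by rw [det_neg_left, det_swap, neg_neg, F.det_eq]
  mem_fst W := by
    refine (F.mem_snd W).trans ?_
    rw [reg_neg, show -y + x = x - y by abel]; tauto
  mem_snd W := by
    refine (F.mem_fst W).trans ?_
    rw [reg_neg, show -y - x = -(x + y) by abel, reg_neg]; tauto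

lemma side_fst (F : Frame e x y) {X : Region} (hX : X ∈ e.fst.1) : 0 ≤ side x y X := by
  rcases (F.mem_fst X).1 hX with rfl | rfl | rfl
  · exact (side_left F.det_eq).ge
  · exact (side_right F.det_eq).ge
  · rw [side_add F.det_eq]; exact zero_le_one

lemma side_snd (F : Frame e x y) {X : Region} (hX : X ∈ e.snd.1) : side x y X ≤ 0 := by
  rcases (F.mem_snd X).1 hX with rfl | rfl | rfl
  · exact (side_left F.det_eq).le
  · exact (side_right F.det_eq).le
  · rw [side_sub F.det_eq]; omega

lemma mem_omegaZero_iff (F : Frame e x y) {X : Region} : X ∈ omegaZero e ↔ side x y X = 0 := by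
  constructor
  · exact fun h => le_antisymm (F.side_snd h.2) (F.side_fst h.1)
  · intro h
    rcases eq_of_side_eq_zero F.det_eq h with rfl | rfl
    · exact ⟨(F.mem_fst _).2 (by tauto), (F.mem_snd _).2 (by tauto)⟩
    · exact ⟨(F.mem_fst _).2 (by tauto), (F.mem_snd _).2 (by tauto)⟩

lemma natUnimod (F : Frame e x y) {a b c d : ℕ} (h : NatUnimod a b c d) :
    Unimod (comb x y a b) (comb x y c d) := (natUnimod_iff F.det_eq).1 h

lemma side_tri (F : Frame e x y) {a b c d : ℕ} (h : NatUnimod a b c d) {X : Region}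
    (hX : X ∈ (tri _ _ (F.natUnimod h)).1) : 0 ≤ side x y X := by
  have hu := F.natUnimod h
  rcases (mem_tri _ X).1 hX with rfl | rfl | rfl
  · rw [side_comb F.det_eq hu.isCoprime]; positivity
  · rw [side_comb F.det_eq hu.symm.isCoprime]; positivity
  · have := hu.add_right.isCoprime
    rw [← comb_add] at this ⊢
    rw [side_comb F.det_eq this]; positivity

lemma snd_ne_of_side (F : Frame e x y) {t : Vertex} (h : ∀ X ∈ t.1, 0 ≤ side x y X) :
    t ≠ e.snd := by
  rintro rfl
  have := h _ ((F.mem_snd (reg (x - y))).2 (by tauto))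
  rw [side_sub F.det_eq] at this
  omega

lemma fst_eq_of_side (F : Frame e x y) {t : Vertex} (h : ∀ X ∈ t.1, 0 ≤ side x y X)
    (hx : reg x ∈ t.1) (hy : reg y ∈ t.1) : t = e.fst := by
  obtain ⟨Z, hZ, hm⟩ := exists_third hx hy F.unimod.adj.ne
  have hZs := h Z ((hm Z).2 (by tauto))
  refine vertex_ext fun W => ?_
  rw [hm, F.mem_fst]
  suffices Z = reg (x + y) by rw [this]
  obtain ⟨a, b, hc, rfl⟩ := exists_comb_of_side_nonneg F.det_eq hZs
  have h1 := Unimod.of_adj F.unimod.symm.isCoprime hc hZ.2.1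
  have h2 := Unimod.of_adj F.unimod.isCoprime hc hZ.2.2
  have ha : a = 1 := by
    have := h1.symm
    rw [Unimod, det_comb_right F.det_eq] at this
    simpa using this
  have hb : b = 1 := by
    have := h2
    rw [Unimod, det_left_comb F.det_eq] at this
    simpa using this
  simp [ha, hb, comb]

/-- Vertices on the nonnegative side are reached from the tail without crossing the edge. -/
lemma exists_walk (F : Frame e x y) {a b c d : ℕ} (h : NatUnimod a b c d) :
    ∃ p : (tree.deleteEdges {e.edge}).Walk e.fst (tri _ _ (F.natUnimod h)),
      p.length ≤ max (euclidDepth a b) (euclidDepth c d) := by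
  induction hn : a + b + (c + d) using Nat.strong_induction_on generalizing a b c d with
  | _ n ih =>
    have hsymm : ∀ {a b c d : ℕ} (h : NatUnimod a b c d),
        tri _ _ (F.natUnimod h) = tri _ _ (F.natUnimod h.symm) := by
      intro a b c d h
      refine vertex_ext fun W => ?_
      rw [mem_tri, mem_tri, add_comm]; tauto
    have key : ∀ a b c d : ℕ, ∀ h : NatUnimod a b c d, a + b + (c + d) = n → a ≤ c → b ≤ d →
        ∃ p : (tree.deleteEdges {e.edge}).Walk e.fst (tri _ _ (F.natUnimod h)),
          p.length ≤ max (euclidDepth a b) (euclidDepth c d) := by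
      intro a b c d h hn hac hbd
      obtain ⟨i, rfl⟩ := Nat.exists_eq_add_of_le hac
      obtain ⟨j, rfl⟩ := Nat.exists_eq_add_of_le hbd
      have h' := h.of_add
      have hab : 0 < a + b := by
        by_contra h0
        have : a = 0 ∧ b = 0 := by omega
        simp [NatUnimod, this.1, this.2] at h
      -- Subtracting the smaller vector from the larger gives the previous triangle on the way back
      -- to the tail. The two triangles share the pair of regions in `h`, and neither is the head of
      -- `e`, so the edge between them is not the deleted one.
      obtain ⟨p, hp⟩ := ih (a + b + (i + j)) (by omega) h' rfl
      have hadj : (tree.deleteEdges {e.edge}).Adj (tri _ _ (F.natUnimod h'))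
          (tri _ _ (F.natUnimod h)) := by
        rw [SimpleGraph.deleteEdges_adj]
        refine ⟨⟨fun heq => ?_, reg (comb x y a b), reg (comb x y (a + i) (b + j)),
          (F.natUnimod h).adj.ne, ⟨?_, ?_⟩, ?_, ?_⟩, fun hmem => ?_⟩
        · have hm : reg (comb x y a b + comb x y (a + i) (b + j)) ∈
              (tri _ _ (F.natUnimod h')).1 := by
            rw [heq, mem_tri]; tauto
          rw [mem_tri] at hm
          rcases hm with hm | hm | hm
          · exact (F.natUnimod h).left_add.adj.ne hm.symm
          · refine (F.natUnimod h).symm.reg_add_ne_reg_sub ?_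
            rw [add_comm, hm, comb_add]
            congr 1
            abel
          · refine (F.natUnimod h).add_right.adj.ne ?_
            rw [hm, comb_add]
        · rw [mem_tri]; tauto
        · rw [mem_tri, comb_add]; tauto
        · rw [mem_tri]; tauto
        · rw [mem_tri]; tauto
        · have h1 := F.snd_ne_of_side fun X => F.side_tri h'
          have h2 := F.snd_ne_of_side fun X => F.side_tri h
          have : s(tri _ _ (F.natUnimod h'), tri _ _ (F.natUnimod h)) = s(e.fst, e.snd) := hmem
          rw [Sym2.eq_iff] at this
          rcases this with h | h
          · exact h2 h.2
          · exact h1 h.1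
      refine ⟨p.concat hadj, ?_⟩
      rw [SimpleGraph.Walk.length_concat, h'.euclidDepth_add]
      omega
    have base : ∀ h : NatUnimod 1 0 0 1,
        ∃ p : (tree.deleteEdges {e.edge}).Walk e.fst (tri _ _ (F.natUnimod h)),
          p.length ≤ max (euclidDepth 1 0) (euclidDepth 0 1) := by
      intro h
      have : tri _ _ (F.natUnimod h) = e.fst := by
        refine F.fst_eq_of_side (fun X => F.side_tri h) ?_ ?_ <;> rw [mem_tri] <;> simp [comb]
      rw [this]
      exact ⟨.nil, Nat.zero_le _⟩
    rcases h.comparable with h' | h' | ⟨rfl, rfl, rfl, rfl⟩ | ⟨rfl, rfl, rfl, rfl⟩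
    · exact key a b c d h hn h'.1 h'.2
    · rw [hsymm h, max_comm]
      exact key c d a b h.symm (by omega) h'.1 h'.2
    · exact base h
    · rw [hsymm h, max_comm]
      exact base h.symm

lemma exists_eq_tri (F : Frame e x y) {t : Vertex} (h : ∀ X ∈ t.1, 0 ≤ side x y X) :
    ∃ a b c d : ℕ, ∃ hn : NatUnimod a b c d, t = tri _ _ (F.natUnimod hn) := by
  obtain ⟨X, Y, Z, hm, ht⟩ := exists_meetAtVertex t
  obtain ⟨a, b, c, d, hn, hs, -⟩ := exists_comb_of_meetAtVertex F.det_eq hm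
    (h X ((ht X).2 (by tauto))) (h Y ((ht Y).2 (by tauto))) (h Z ((ht Z).2 (by tauto)))
  refine ⟨a, b, c, d, hn, vertex_ext fun W => ?_⟩
  have := Set.ext_iff.1 hs W
  simp only [Set.mem_insert_iff, Set.mem_singleton_iff] at this
  rw [ht, mem_tri, this, comb_add]

lemma reachable_of_side (F : Frame e x y) {t : Vertex} (h : ∀ X ∈ t.1, 0 ≤ side x y X) :
    (tree.deleteEdges {e.edge}).Reachable e.fst t := by
  obtain ⟨a, b, c, d, hn, rfl⟩ := F.exists_eq_tri h
  obtain ⟨p, -⟩ := F.exists_walk hn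
  exact ⟨p⟩

lemma adj_of_mem {t : Vertex} {X Y : Region} (hX : X ∈ t.1) (hY : Y ∈ t.1) (h : X ≠ Y) :
    fareyGraph.Adj X Y := by
  obtain ⟨Z, hZ, -⟩ := exists_third hX hY h
  exact hZ.1

/-- Each vertex lies on one of the two sides. -/
lemma side_cases (F : Frame e x y) (t : Vertex) :
    (∀ X ∈ t.1, 0 ≤ side x y X) ∨ (∀ X ∈ t.1, side x y X ≤ 0) := by
  by_cases h : ∃ X ∈ t.1, side x y X < 0
  · obtain ⟨X, hX, hs⟩ := h
    right
    intro Y hY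
    rcases eq_or_ne X Y with rfl | hne
    · exact hs.le
    · exact side_nonpos_of_adj F.det_eq (adj_of_mem hX hY hne) hs
  · push Not at h
    exact Or.inl h

lemma reachable_snd (F : Frame e x y) (t : Vertex) : tree.Reachable e.snd t := by
  rcases F.side_cases t with h | h
  · have h1 := (F.reachable_of_side h).mono (SimpleGraph.deleteEdges_le _)
    exact e.adj.symm.reachable.trans h1
  · refine (F.symm.reachable_of_side (t := t) fun X hX => ?_).mono (SimpleGraph.deleteEdges_le _)
    rw [side_swap]
    have := h X hX
    omega

/-- Vertices reachable from the tail without crossing the edge are on the nonnegative side. -/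
lemma side_of_reachable (F : Frame e x y) {t : Vertex}
    (h : (tree.deleteEdges {e.edge}).Reachable e.fst t) : ∀ X ∈ t.1, 0 ≤ side x y X := by
  obtain ⟨p⟩ := h
  suffices H : ∀ (s t : Vertex) (_ : (tree.deleteEdges {e.edge}).Walk s t),
      (∀ X ∈ s.1, 0 ≤ side x y X) → ∀ X ∈ t.1, 0 ≤ side x y X from
    H _ _ p fun X => F.side_fst
  intro s t p
  induction p with
  | nil => exact id
  | @cons s s' t hadj p ih =>
    intro hs
    refine ih ?_
    rw [SimpleGraph.deleteEdges_adj] at hadj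
    obtain ⟨⟨hne, X, Y, hXY, ⟨hX, hY⟩, hX', hY'⟩, hedge⟩ := hadj
    rcases F.side_cases s' with h | h
    · exact h
    exfalso
    -- A step changing sides goes between triangles sharing two regions of side zero. Those are the
    -- two regions containing `e`, so the step would be across the deleted edge.
    have hX0 : side x y X = 0 := le_antisymm (h X hX') (hs X hX)
    have hY0 : side x y Y = 0 := le_antisymm (h Y hY') (hs Y hY)
    have hmem : ∀ u : Vertex, X ∈ u.1 → Y ∈ u.1 → reg x ∈ u.1 ∧ reg y ∈ u.1 := by
      intro u h1 h2
      rcases eq_of_side_eq_zero F.det_eq hX0 with rfl | rfl <;>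
        rcases eq_of_side_eq_zero F.det_eq hY0 with rfl | rfl
      · exact absurd rfl hXY
      · exact ⟨h1, h2⟩
      · exact ⟨h2, h1⟩
      · exact absurd rfl hXY
    have e1 : s = e.fst := F.fst_eq_of_side hs (hmem s hX hY).1 (hmem s hX hY).2
    have e2 : s' = e.symm.fst := F.symm.fst_eq_of_side
      (fun V hV => by rw [side_swap]; have := h V hV; omega)
      (by rw [reg_neg]; exact (hmem s' hX' hY').2) (hmem s' hX' hY').1
    refine hedge ?_
    subst e1 e2
    rfl

lemma mem_omegaMinus_iff (F : Frame e x y) {X : Region} : X ∈ omegaMinus e ↔ 0 < side x y X := by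
  constructor
  · intro h
    obtain ⟨t, ht⟩ := exists_vertex X
    refine lt_of_le_of_ne (F.side_of_reachable (h t ht) X ht) fun h0 => ?_
    have := (F.mem_omegaZero_iff.2 h0.symm).2
    exact F.snd_ne_of_side (F.side_of_reachable (h _ this)) rfl
  · intro h t ht
    refine F.reachable_of_side ?_
    intro Y hY
    rcases eq_or_ne X Y with rfl | hne
    · exact h.le
    · exact side_nonneg_of_adj F.det_eq (adj_of_mem ht hY hne) h

lemma mem_omegaZeroMinus_iff (F : Frame e x y) {X : Region} :
    X ∈ omegaZeroMinus e ↔ 0 ≤ side x y X := by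
  rw [omegaZeroMinus, Set.mem_union, F.mem_omegaZero_iff, F.mem_omegaMinus_iff, le_iff_lt_or_eq,
    or_comm, eq_comm]

/-- Each step keeps two regions and introduces a third, whose depth exceeds theirs by at most one.
Applied from the head of `e`, where all depths are zero, it bounds distances below by depth. -/
lemma depth_le_length (F : Frame e x y) {s t : Vertex} (p : tree.Walk s t) (k : ℕ)
    (hs : ∀ X ∈ s.1, depth x y X ≤ k) : ∀ X ∈ t.1, depth x y X ≤ k + p.length := by
  induction p generalizing k with
  | nil => exact hs
  | @cons s s' t hadj p ih =>
    rw [SimpleGraph.Walk.length_cons, add_comm p.length, ← add_assoc]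
    refine ih (k + 1) fun W hW => ?_
    obtain ⟨-, X, Y, hXY, ⟨hX, hY⟩, hX', hY'⟩ := hadj
    obtain ⟨Z, hZ, hm⟩ := exists_third hX' hY' hXY
    have h1 := hs X hX
    have h2 := hs Y hY
    rcases (hm W).1 hW with rfl | rfl | rfl
    · omega
    · omega
    · have := depth_third_le F.det_eq hZ
      omega

lemma depth_le_dist (F : Frame e x y) {t : Vertex} {X : Region} (hX : X ∈ t.1) :
    depth x y X ≤ tree.dist e.snd t := by
  obtain ⟨p, hp⟩ := (F.reachable_snd t).exists_walk_length_eq_dist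
  rw [← hp, ← zero_add p.length]
  refine F.depth_le_length p 0 (fun Y hY => ?_) X hX
  rw [depth_eq_zero (F.side_snd hY)]

end Frame

/-- Euclidean descent to `(1, 1) = (1, 0) + (0, 1)`; the shears undoing it preserve unimodularity.
-/
lemma exists_parents {a b : ℕ} (h : a.Coprime b) (ha : 0 < a) (hb : 0 < b) :
    ∃ c d c' d' : ℕ, NatUnimod c d c' d' ∧ a = c + c' ∧ b = d + d' := by
  induction hn : a + b using Nat.strong_induction_on generalizing a b with
  | _ n ih =>
    have key : ∀ a b : ℕ, a.Coprime b → 0 < a → 0 < b → a + b = n → a ≤ b →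
        ∃ c d c' d' : ℕ, NatUnimod c d c' d' ∧ a = c + c' ∧ b = d + d' := by
      intro a b h ha hb hn hab
      obtain ⟨i, rfl⟩ := Nat.exists_eq_add_of_le hab
      rcases Nat.eq_zero_or_pos i with rfl | hi
      · have : a = 1 := by simpa using h
        subst this
        exact ⟨1, 0, 0, 1, by simp [NatUnimod], rfl, rfl⟩
      · obtain ⟨c, d, c', d', hu, h1, h2⟩ := ih (a + i) (by omega) (by simpa using h) ha hi rfl
        exact ⟨c, c + d, c', c' + d', hu.shear, h1, by omega⟩
    rcases le_total a b with hab | hab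
    · exact key a b h ha hb hn hab
    · obtain ⟨c, d, c', d', hu, h1, h2⟩ := key b a h.symm hb ha (by omega) hab
      exact ⟨d, c, d', c', hu.swap, h2, h1⟩

namespace Frame

variable {e : tree.Dart} {x y : ℤ × ℤ}

lemma exists_parents (F : Frame e x y) {Z : Region} (hZ : 0 < side x y Z) :
    ∃ a b c d : ℕ, NatUnimod a b c d ∧ Z = reg (comb x y a b + comb x y c d) := by
  obtain ⟨m, n, hc, rfl⟩ := exists_comb_of_side_nonneg F.det_eq hZ.le
  rw [side_comb F.det_eq hc] at hZ
  have hmn : m.Coprime n := by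
    rw [Nat.coprime_iff_isRelPrime]
    intro k hk1 hk2
    have hk1' : (k : ℤ) ∣ m := by exact_mod_cast hk1
    have hk2' : (k : ℤ) ∣ n := by exact_mod_cast hk2
    have : IsUnit (k : ℤ) := by
      refine hc.isUnit_of_dvd' ?_ ?_
      · simpa [comb] using dvd_add (hk1'.mul_right _) (hk2'.mul_right _)
      · simpa [comb] using dvd_add (hk1'.mul_right _) (hk2'.mul_right _)
    exact Int.ofNat_isUnit.1 this
  have hm : 0 < m := Nat.pos_of_ne_zero (by rintro rfl; simp at hZ)
  have hn : 0 < n := Nat.pos_of_ne_zero (by rintro rfl; simp at hZ)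
  obtain ⟨a, b, c, d, hu, rfl, rfl⟩ := MarkoffFarey.exists_parents hmn hm hn
  exact ⟨a, b, c, d, hu, by rw [comb_add]⟩

/-- From above: cross `e` and walk to the triangle formed by `Z` and its parents. Crossing `e` costs
the extra one by which the depth of `Z` exceeds the maximum of the parents' depths. From below:
`depth_le_dist`. -/
lemma regionDist_eq (F : Frame e x y) {Z : Region} (hZ : 0 ≤ side x y Z) :
    regionDist e Z = depth x y Z := by
  refine le_antisymm ?_ ?_
  · suffices ∃ t : Vertex, Z ∈ t.1 ∧ tree.dist e.snd t ≤ depth x y Z by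
      obtain ⟨t, ht, hd⟩ := this
      refine le_trans (csInf_le (OrderBot.bddBelow _) ?_) hd
      exact ⟨t, ht, rfl⟩
    rcases hZ.eq_or_lt with h0 | h0
    · exact ⟨e.snd, (F.mem_omegaZero_iff.2 h0.symm).2, by simp⟩
    · obtain ⟨a, b, c, d, hn, rfl⟩ := F.exists_parents h0
      have hu := (F.natUnimod hn).add_right.isCoprime
      obtain ⟨p, hp⟩ := F.exists_walk hn
      refine ⟨tri _ _ (F.natUnimod hn), (mem_tri _ _).2 (by tauto), ?_⟩
      rw [← comb_add] at hu ⊢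
      rw [depth_comb F.det_eq hu, hn.euclidDepth_add]
      refine le_trans (SimpleGraph.dist_le
        (SimpleGraph.Walk.cons e.adj.symm (p.mapLe (SimpleGraph.deleteEdges_le _)))) ?_
      simpa using hp
  · obtain ⟨t, ht⟩ := exists_vertex Z
    refine le_csInf ⟨_, t, ht, rfl⟩ ?_
    rintro n ⟨t, ht, rfl⟩
    exact F.depth_le_dist ht

lemma regionDist_comb (F : Frame e x y) {a b : ℕ}
    (h : IsCoprime (comb x y a b).1 (comb x y a b).2) :
    regionDist e (reg (comb x y a b)) = euclidDepth a b := by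
  rw [F.regionDist_eq (by rw [side_comb F.det_eq h]; positivity), depth_comb F.det_eq h]

/-- The regions over which the Fibonacci recursion sums are the two parents. -/
lemma parents_eq (F : Frame e x y) {a b c d : ℕ} (hn : NatUnimod a b c d) :
    {X | X ∈ omegaZeroMinus e ∧ fareyGraph.Adj X (reg (comb x y a b + comb x y c d)) ∧
      regionDist e X < regionDist e (reg (comb x y a b + comb x y c d))} =
      {reg (comb x y a b), reg (comb x y c d)} := by
  have hu := F.natUnimod hn
  have hcz := hu.add_right.isCoprime
  have hz := hcz
  rw [← comb_add] at hz
  have hdz := F.regionDist_comb hz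
  rw [comb_add, hn.euclidDepth_add] at hdz
  have hdp := F.regionDist_comb hu.isCoprime
  have hdq := F.regionDist_comb hu.symm.isCoprime
  ext X
  simp only [Set.mem_ofPred_eq, Set.mem_insert_iff, Set.mem_singleton_iff]
  constructor
  · rintro ⟨-, hadj, hlt⟩
    -- beyond the first two, the neighbours are sums of the region and a natural vector
    have far : ∀ (a b c d : ℕ), NatUnimod a b c d → ∀ n : ℕ,
        regionDist e (reg (comb x y a b + comb x y c d)) <
          regionDist e (reg ((n + 1 : ℤ) • (comb x y a b + comb x y c d) + comb x y a b)) := by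
      intro a b c d hn n
      have hun : NatUnimod (a + c) (b + d) (n * (a + c) + a) (n * (b + d) + b) := by
        have h0 := (F.natUnimod hn)
        rw [natUnimod_iff F.det_eq, Unimod, det_comb_comb F.det_eq]
        rw [Unimod, det_comb_comb F.det_eq, ← abs_neg] at h0
        rw [← h0]
        congr 1
        push_cast
        ring
      have h1 := (F.natUnimod hun).isCoprime
      have h2 := (F.natUnimod hun).add_right.isCoprime
      rw [← comb_add] at h2
      have e1 : comb x y (a + c + (n * (a + c) + a)) (b + d + (n * (b + d) + b)) =
          (n + 1 : ℤ) • (comb x y a b + comb x y c d) + comb x y a b := by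
        simp only [comb]
        push_cast
        module
      rw [← e1, ← comb_add, F.regionDist_comb h1, F.regionDist_comb h2, hun.euclidDepth_add]
      omega
    -- With `z = P + Q`, the neighbours of `z` are the vectors `n z + P` up to sign. The parents are
    -- `n = 0` and `n = -1`, since `P - z = -Q`; every other neighbour is deeper than `z` by `far`.
    obtain ⟨n, hX⟩ : ∃ n : ℤ,
        X = reg (n • (comb x y a b + comb x y c d) + comb x y a b) := by
      set z := comb x y a b + comb x y c d
      have hzp : Unimod z (comb x y a b) := hu.left_add.symm
      have hXz := adj_iff.1 hadj
      have hzX : det z (vec X) = 1 ∨ det z (vec X) = -1 := by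
        rcases vec_reg hcz with h | h <;> rw [h] at hXz
        · exact hXz.symm.cases
        · have := hXz.symm.neg_left
          rw [neg_neg] at this
          exact this.cases
      have hv := hzp.eq_smul_add_smul (vec X)
      have : det z (comb x y a b) * det z (vec X) = 1 ∨
          det z (comb x y a b) * det z (vec X) = -1 := by
        rcases hzp.cases with h1 | h1 <;> rcases hzX with h2 | h2 <;> simp [h1, h2]
      rcases this with h | h <;> rw [h] at hv
      · refine ⟨det z (comb x y a b) * det (vec X) (comb x y a b), ?_⟩
        conv_lhs => rw [← reg_vec X, hv, one_smul]
      · refine ⟨-(det z (comb x y a b) * det (vec X) (comb x y a b)), ?_⟩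
        conv_lhs => rw [← reg_vec X, hv, ← reg_neg]
        congr 1
        module
    rcases lt_trichotomy n 0 with h0 | h0 | h0
    · obtain ⟨k, hk⟩ : ∃ k : ℕ, n = -1 - k := ⟨(-1 - n).toNat, by omega⟩
      have hX' : X = reg ((k : ℤ) • (comb x y a b + comb x y c d) + comb x y c d) := by
        rw [hX, ← reg_neg, hk]
        congr 1
        module
      rcases k with _ | k
      · right
        simpa using hX'
      · exfalso
        have := far c d a b hn.symm k
        rw [add_comm (comb x y c d) (comb x y a b)] at this
        rw [hX'] at hlt
        push_cast at hlt
        omega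
    · left
      simpa [h0] using hX
    · exfalso
      obtain ⟨k, hk⟩ : ∃ k : ℕ, n = k + 1 := ⟨(n - 1).toNat, by omega⟩
      have := far a b c d hn k
      rw [hX, hk] at hlt
      omega
  · rintro (rfl | rfl)
    · refine ⟨?_, hu.left_add.adj, by omega⟩
      rw [F.mem_omegaZeroMinus_iff, side_comb F.det_eq hu.isCoprime]
      positivity
    · refine ⟨?_, hu.add_right.symm.adj, by omega⟩
      rw [F.mem_omegaZeroMinus_iff, side_comb F.det_eq hu.symm.isCoprime]
      positivity

end Frame

/-! ### Fibonacci functions and the `ℓ¹` norm -/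

/-- The sum of the absolute values of the coordinates of a region. -/
def coordSum (x y : ℤ × ℤ) (X : Region) : ℕ := (det (vec X) y).natAbs + (det x (vec X)).natAbs

lemma coordSum_comb {x y : ℤ × ℤ} (hxy : det x y = 1) {a b : ℕ}
    (h : IsCoprime (comb x y a b).1 (comb x y a b).2) :
    coordSum x y (reg (comb x y a b)) = a + b := by
  rw [coordSum]
  rcases vec_reg h with h | h <;>
    simp [h, det_neg_left, det_neg_right, det_comb_right hxy, det_left_comb hxy]

namespace Frame

variable {e : tree.Dart} {x y : ℤ × ℤ}

/-- Coordinates of a mediant are the sums of those of its parents, so the coordinate sum obeys the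
Fibonacci recursion. -/
lemma fibDirected_eq (F : Frame e x y) {Z : Region} (hZ : 0 ≤ side x y Z) :
    fibDirected e Z = coordSum x y Z := by
  induction hn : coordSum x y Z using Nat.strong_induction_on generalizing Z with
  | _ n ih =>
    rw [fibDirected]
    split_ifs with h0
    · rw [F.mem_omegaZero_iff] at h0
      have h1 : NatUnimod 1 0 0 1 := by simp [NatUnimod]
      have hu := F.natUnimod h1
      have e1 := coordSum_comb F.det_eq hu.isCoprime
      have e2 := coordSum_comb F.det_eq hu.symm.isCoprime
      simp only [comb, Nat.cast_one, Nat.cast_zero, one_smul, zero_smul, zero_add, add_zero]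
        at e1 e2
      rcases eq_of_side_eq_zero F.det_eq h0 with rfl | rfl
      · rw [← hn, e1]
      · rw [← hn, e2]
    · rw [F.mem_omegaZero_iff] at h0
      obtain ⟨a, b, c, d, hu, rfl⟩ := F.exists_parents (lt_of_le_of_ne hZ (Ne.symm h0))
      have hU := F.natUnimod hu
      have hc := hU.add_right.isCoprime
      rw [← comb_add] at hc
      have e1 := coordSum_comb F.det_eq hU.isCoprime
      have e2 := coordSum_comb F.det_eq hU.symm.isCoprime
      have e3 := coordSum_comb F.det_eq hc
      rw [comb_add, hn] at e3
      have hab : 0 < a + b := by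
        by_contra h0
        have : a = 0 ∧ b = 0 := by omega
        simp [NatUnimod, this.1, this.2] at hu
      have hcd : 0 < c + d := by
        by_contra h0
        have : c = 0 ∧ d = 0 := by omega
        simp [NatUnimod, this.1, this.2] at hu
      have hs := finsum_set_coe_eq_finsum_mem (f := fibDirected e)
        {X | X ∈ omegaZeroMinus e ∧ fareyGraph.Adj X (reg (comb x y a b + comb x y c d)) ∧
          regionDist e X < regionDist e (reg (comb x y a b + comb x y c d))}
      refine hs.trans ?_
      -- The index set is exactly a pair of distinct regions, so the `finsum` is a genuine sum
      -- rather than its default value `0`.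
      rw [F.parents_eq hu, finsum_mem_pair hU.adj.ne,
        ih (a + b) (by omega) (by rw [side_comb F.det_eq hU.isCoprime]; positivity) e1,
        ih (c + d) (by omega) (by rw [side_comb F.det_eq hU.symm.isCoprime]; positivity) e2]
      omega

lemma fib_eq (F : Frame e x y) (X : Region) : fib e X = coordSum x y X := by
  rw [fib]
  split_ifs with h
  · exact F.fibDirected_eq (F.mem_omegaZeroMinus_iff.1 h)
  · rw [F.mem_omegaZeroMinus_iff] at h
    rw [F.symm.fibDirected_eq (by rw [side_swap]; omega)]
    simp only [coordSum, det_neg_left, Int.natAbs_neg, det_swap (vec X) x, det_swap y (vec X)]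
    rw [add_comm]

end Frame

/-- The `ℓ¹` norm of an integer vector. -/
def norm₁ (u : ℤ × ℤ) : ℝ := |(u.1 : ℝ)| + |(u.2 : ℝ)|

lemma norm₁_nonneg (u : ℤ × ℤ) : 0 ≤ norm₁ u := by unfold norm₁; positivity

lemma norm₁_add_le (u v : ℤ × ℤ) : norm₁ (u + v) ≤ norm₁ u + norm₁ v := by
  have h1 := abs_add_le (u.1 : ℝ) v.1
  have h2 := abs_add_le (u.2 : ℝ) v.2
  simp only [norm₁, Prod.fst_add, Prod.snd_add, Int.cast_add]
  linarith

lemma norm₁_smul (n : ℤ) (u : ℤ × ℤ) : norm₁ (n • u) = |(n : ℝ)| * norm₁ u := by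
  simp [norm₁, abs_mul, mul_add]

lemma abs_det_le (u v : ℤ × ℤ) : |(det u v : ℝ)| ≤ norm₁ u * norm₁ v := by
  have h := abs_sub (u.1 * v.2 : ℝ) (u.2 * v.1)
  rw [abs_mul, abs_mul] at h
  simp only [det, Int.cast_sub, Int.cast_mul, norm₁]
  nlinarith [abs_nonneg (u.1 : ℝ), abs_nonneg (u.2 : ℝ), abs_nonneg (v.1 : ℝ),
    abs_nonneg (v.2 : ℝ)]

/-- Fibonacci functions are comparable to the norm. -/
lemma exists_fib_bounds (e : tree.Dart) : ∃ K : ℝ, 0 < K ∧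
    (∀ X, norm₁ (vec X) ≤ K * fib e X) ∧ ∀ X, fib e X ≤ K * norm₁ (vec X) := by
  obtain ⟨x, y, F⟩ := exists_frame e
  have hx := norm₁_nonneg x
  have hy := norm₁_nonneg y
  have hcast : ∀ X, (fib e X : ℝ) = |(det (vec X) y : ℝ)| + |(det x (vec X) : ℝ)| := by
    intro X
    rw [F.fib_eq, coordSum]
    push_cast [Nat.cast_natAbs]
    rfl
  refine ⟨norm₁ x + norm₁ y + 1, by positivity, fun X => ?_, fun X => ?_⟩
  · have h := F.unimod.eq_smul_add_smul (vec X)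
    rw [F.det_eq, one_mul, one_mul] at h
    rw [hcast]
    have h1 := norm₁_add_le (det (vec X) y • x) (det x (vec X) • y)
    rw [← h, norm₁_smul, norm₁_smul] at h1
    nlinarith [abs_nonneg (det (vec X) y : ℝ), abs_nonneg (det x (vec X) : ℝ)]
  · rw [hcast]
    have h1 := abs_det_le (vec X) y
    have h2 := abs_det_le x (vec X)
    have := norm₁_nonneg (vec X)
    nlinarith


open Filter Topology

/-! ### Linear recurrences -/

/-- The roots of `t² + x t + 1` are inverse to each other. On the unit circle their sum would be
twice a real part, so `x` would lie in `[-2, 2]`. -/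
lemma exists_multiplier {x : ℂ} (hx : x ∉ (fun t : ℝ => (t : ℂ)) '' Set.Icc (-2) 2) :
    ∃ l : ℂ, 1 < ‖l‖ ∧ l + l⁻¹ = -x := by
  obtain ⟨d, hd⟩ := IsAlgClosed.exists_pow_nat_eq (x ^ 2 - 4) (n := 2) two_pos
  set l : ℂ := (-x + d) / 2 with hl
  have hmul : l * ((-x - d) / 2) = 1 := by
    rw [hl]; linear_combination (-1 / 4 : ℂ) * hd
  have hl0 : l ≠ 0 := left_ne_zero_of_mul_eq_one hmul
  have hinv : l⁻¹ = (-x - d) / 2 := inv_eq_of_mul_eq_one_right hmul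
  have hsum : l + l⁻¹ = -x := by rw [hinv, hl]; ring
  rcases lt_trichotomy ‖l‖ 1 with h | h | h
  · refine ⟨l⁻¹, ?_, by rw [inv_inv, add_comm, hsum]⟩
    rw [norm_inv]
    exact (one_lt_inv₀ (norm_pos_iff.2 hl0)).2 h
  · exfalso
    apply hx
    rw [Complex.inv_eq_conj h, Complex.add_conj] at hsum
    have hre := abs_le.1 ((Complex.abs_re_le_norm l).trans h.le)
    refine ⟨-(2 * l.re), ⟨by linarith, by linarith⟩, ?_⟩
    push_cast at hsum ⊢
    rw [hsum, neg_neg]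
  · exact ⟨l, h, hsum⟩

/-- The second conclusion evaluates the quadratic form of the homogenised conic on `(w 0, w 1)`: the
form vanishes exactly when one of the two exponentials is absent. -/
lemma exists_eq_zpow_add_zpow {l : ℂ} (hl : 1 < ‖l‖) {w : ℤ → ℂ}
    (hw : ∀ n, w (n + 1) + w (n - 1) = (l + l⁻¹) * w n) :
    ∃ A B : ℂ, (∀ n, w n = A * l ^ n + B * l ^ (-n)) ∧
      w 0 ^ 2 + w 1 ^ 2 - (l + l⁻¹) * w 0 * w 1 = -(A * B * (l - l⁻¹) ^ 2) := by
  have hl0 : l ≠ 0 := norm_pos_iff.1 (one_pos.trans hl)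
  have hd : l - l⁻¹ ≠ 0 := by
    intro h
    have h1 : ‖l‖ = ‖l‖⁻¹ := by rw [← norm_inv, ← sub_eq_zero.1 h]
    have h2 : ‖l‖⁻¹ < 1 := inv_lt_one_of_one_lt₀ hl
    linarith
  obtain ⟨A, hA⟩ : ∃ A, A = (w 1 - l⁻¹ * w 0) / (l - l⁻¹) := ⟨_, rfl⟩
  obtain ⟨B, hB⟩ : ∃ B, B = (l * w 0 - w 1) / (l - l⁻¹) := ⟨_, rfl⟩
  rw [eq_div_iff hd] at hA hB
  have e0 : w 0 = A + B := by
    apply mul_right_cancel₀ hd; linear_combination -hA - hB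
  have e1 : w 1 = A * l + B * l⁻¹ := by
    apply mul_right_cancel₀ hd; linear_combination (-l) * hA - l⁻¹ * hB
  have key : ∀ n : ℤ, w n = A * l ^ n + B * l ^ (-n) ∧
      w (n + 1) = A * l ^ (n + 1) + B * l ^ (-(n + 1)) := by
    have hz : ∀ n : ℤ, l ^ (n + 1) = l ^ n * l ∧ l ^ (-(n + 1)) = l ^ (-n) * l⁻¹ := by
      intro n
      refine ⟨zpow_add_one₀ hl0 n, ?_⟩
      rw [neg_add, ← sub_eq_add_neg, zpow_sub_one₀ hl0]
    have hll : l * l⁻¹ = 1 := mul_inv_cancel₀ hl0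
    intro n
    induction n using Int.induction_on with
    | zero => exact ⟨by simpa using e0, by simpa using e1⟩
    | succ i ih =>
      refine ⟨ih.2, ?_⟩
      have h := hw (i + 1)
      rw [add_sub_cancel_right, ih.1, ih.2] at h
      obtain ⟨h1, h2⟩ := hz i
      obtain ⟨h3, h4⟩ := hz (i + 1)
      rw [h3, h4, h1, h2]
      rw [h1, h2] at h
      linear_combination h + (A * l ^ (i : ℤ) + B * l ^ (-(i : ℤ))) * hll
    | pred i ih =>
      have hi : (-(i : ℤ) - 1 + 1) = -(i : ℤ) := by ring
      rw [hi]
      refine ⟨?_, ih.1⟩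
      have h := hw (-(i : ℤ))
      rw [ih.1, ih.2] at h
      obtain ⟨h1, h2⟩ := hz (-(i : ℤ) - 1)
      obtain ⟨h3, h4⟩ := hz (-(i : ℤ))
      rw [hi] at h1 h2
      rw [h3, h4, h1, h2] at h
      linear_combination h + (A * l ^ (-(i : ℤ) - 1) + B * l ^ (-(-(i : ℤ) - 1))) * hll
  refine ⟨A, B, fun n => (key n).1, ?_⟩
  rw [e0, e1]
  field_simp
  ring

/-- At most one exponential remains, and it decays in one of the two directions. -/
lemma infinite_norm_le_one {l A B : ℂ} (hl : 1 < ‖l‖) (h : A * B = 0) :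
    {n : ℤ | ‖A * l ^ n + B * l ^ (-n)‖ ≤ 1}.Infinite := by
  have main : ∀ A : ℂ, ∃ N : ℕ, ∀ n : ℕ, N ≤ n → ‖A * l ^ (-(n : ℤ))‖ ≤ 1 := by
    intro A
    have h1 : Tendsto (fun n : ℕ => ‖A‖ * (‖l‖⁻¹) ^ n) atTop (𝓝 (‖A‖ * 0)) :=
      (tendsto_pow_atTop_nhds_zero_of_lt_one (by positivity)
        (inv_lt_one_of_one_lt₀ hl)).const_mul _
    rw [mul_zero] at h1
    obtain ⟨N, hN⟩ := eventually_atTop.1 (h1.eventually (ge_mem_nhds zero_lt_one))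
    refine ⟨N, fun n hn => ?_⟩
    rw [norm_mul, norm_zpow, zpow_neg, zpow_natCast, ← inv_pow]
    exact hN n hn
  rcases mul_eq_zero.1 h with rfl | rfl
  · obtain ⟨N, hN⟩ := main B
    refine Set.infinite_of_injective_forall_mem (f := fun n : ℕ => ((N + n : ℕ) : ℤ))
      (fun a b hab => by simpa using hab) fun n => ?_
    simpa only [zero_mul, zero_add, Set.mem_ofPred_eq] using hN (N + n) (Nat.le_add_right _ _)
  · obtain ⟨N, hN⟩ := main A
    refine Set.infinite_of_injective_forall_mem (f := fun n : ℕ => -((N + n : ℕ) : ℤ))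
      (fun a b hab => by simpa using hab) fun n => ?_
    simpa using hN (N + n) (Nat.le_add_right _ _)

lemma eventually_pow_le_norm {l A B : ℂ} (hl : 1 < ‖l‖) (hA : A ≠ 0) (K : ℝ) :
    ∃ c : ℝ, 0 < c ∧ ∀ᶠ n : ℕ in atTop,
      c * ‖l‖ ^ n + K ≤ ‖A * l ^ (n : ℤ) + B * l ^ (-(n : ℤ))‖ := by
  have hA' : 0 < ‖A‖ := norm_pos_iff.2 hA
  refine ⟨‖A‖ / 2, by positivity, ?_⟩
  have h1 := (tendsto_pow_atTop_atTop_of_one_lt hl).eventually_ge_atTop ((K + ‖B‖) / (‖A‖ / 2))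
  filter_upwards [h1] with n hn
  rw [div_le_iff₀ (by positivity)] at hn
  have h2 : ‖B * l ^ (-(n : ℤ))‖ ≤ ‖B‖ := by
    rw [norm_mul, norm_zpow, zpow_neg, zpow_natCast]
    refine mul_le_of_le_one_right (norm_nonneg _) (inv_le_one_of_one_le₀ (one_le_pow₀ hl.le))
  have h3 : ‖A * l ^ (n : ℤ)‖ = ‖A‖ * ‖l‖ ^ n := by rw [norm_mul, norm_zpow, zpow_natCast]
  have h4 := norm_sub_le (A * l ^ (n : ℤ) + B * l ^ (-(n : ℤ))) (B * l ^ (-(n : ℤ)))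
  rw [add_sub_cancel_right, h3] at h4
  linarith

/-! ### Markoff maps on the lattice -/

/-- A Markoff map, viewed as a function on integer vectors; only its values on primitive vectors
matter. -/
structure IsLatticeMarkoff (p : Fin 3 → ℂ) (s : ℂ) (k : ℤ × ℤ → Fin 3) (ψ : ℤ × ℤ → ℂ) : Prop where
  neg : ∀ u, ψ (-u) = ψ u
  color_ne : ∀ {u v}, Unimod u v → k u ≠ k v
  color_add : ∀ {u v}, Unimod u v → k (u + v) = k (u - v)
  edge : ∀ {u v}, Unimod u v → ψ (u + v) + ψ (u - v) = p (k (u + v)) - ψ u * ψ v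
  vertex : ∀ {u v}, Unimod u v → ψ u ^ 2 + ψ v ^ 2 + ψ (u + v) ^ 2 + ψ u * ψ v * ψ (u + v) =
    p (k u) * ψ u + p (k v) * ψ v + p (k (u + v)) * ψ (u + v) + s

lemma fin_three_cases : ∀ {a b c : Fin 3}, a ≠ b → a ≠ c → b ≠ c →
    (a = 0 ∧ b = 1 ∧ c = 2) ∨ (a = 1 ∧ b = 0 ∧ c = 2) ∨ (a = 0 ∧ b = 2 ∧ c = 1) ∨
    (a = 2 ∧ b = 0 ∧ c = 1) ∨ (a = 1 ∧ b = 2 ∧ c = 0) ∨ (a = 2 ∧ b = 1 ∧ c = 0) := by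
  decide

lemma IsMarkoffMap.isLatticeMarkoff {C : Region → Fin 3} (hC : IsTricoloring C) {p q r s : ℂ}
    {φ : Region → ℂ} (hφ : IsMarkoffMap C p q r s φ) :
    IsLatticeMarkoff ![p, q, r] s (fun u => C (reg u)) (fun u => φ (reg u)) where
  neg u := by rw [reg_neg]
  color_ne h := (hC _ _ _ _ h.isEdge).2.1
  color_add h := (hC _ _ _ _ h.isEdge).1
  edge {u v} h := by
    have he := h.isEdge
    obtain ⟨h1, h2, h3, h4⟩ := hC _ _ _ _ he
    have he' : IsEdge (reg v) (reg u) (reg (u + v)) (reg (u - v)) :=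
      ⟨⟨he.1.1.symm, he.1.2.2, he.1.2.1⟩, ⟨he.2.1.1.symm, he.2.1.2.2, he.2.1.2.1⟩, he.2.2⟩
    generalize reg (u + v) = Z at *
    generalize reg (u - v) = W at *
    generalize reg u = X at *
    generalize reg v = Y at *
    -- The six orders of the colours reduce to the three edge axioms; indexing `p` by colour makes
    -- the relation uniform from here on.
    rcases fin_three_cases h2 h3 h4 with ⟨a, b, c⟩ | ⟨a, b, c⟩ | ⟨a, b, c⟩ | ⟨a, b, c⟩ | ⟨a, b, c⟩ |
      ⟨a, b, c⟩
    · simpa [c] using hφ.edge₃ X Y Z W he a b c (h1 ▸ c)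
    · simpa [c, mul_comm] using hφ.edge₃ Y X Z W he' b a c (h1 ▸ c)
    · simpa [c] using hφ.edge₂ X Y Z W he a c (h1 ▸ c) b
    · simpa [c, mul_comm] using hφ.edge₂ Y X Z W he' b c (h1 ▸ c) a
    · simpa [c] using hφ.edge₁ X Y Z W he c (h1 ▸ c) a b
    · simpa [c, mul_comm] using hφ.edge₁ Y X Z W he' c (h1 ▸ c) b a
  vertex {u v} h := by
    have he := h.isEdge.1
    obtain ⟨-, h2, h3, h4⟩ := hC _ _ _ _ h.isEdge
    generalize reg (u + v) = Z at *
    generalize reg u = X at *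
    generalize reg v = Y at *
    obtain ⟨e1, e2, e3⟩ := he
    rcases fin_three_cases h2 h3 h4 with ⟨a, b, c⟩ | ⟨a, b, c⟩ | ⟨a, b, c⟩ | ⟨a, b, c⟩ | ⟨a, b, c⟩ |
      ⟨a, b, c⟩ <;> simp only [a, b, c, Matrix.cons_val]
    · linear_combination hφ.vertex X Y Z ⟨e1, e2, e3⟩ a b c
    · linear_combination hφ.vertex Y X Z ⟨e1.symm, e3, e2⟩ b a c
    · linear_combination hφ.vertex X Z Y ⟨e3, e2.symm, e1⟩ a c b
    · linear_combination hφ.vertex Y Z X ⟨e2, e3.symm, e1.symm⟩ b c a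
    · linear_combination hφ.vertex Z X Y ⟨e3.symm, e1, e2.symm⟩ c a b
    · linear_combination hφ.vertex Z Y X ⟨e2.symm, e1.symm, e3.symm⟩ c b a

namespace IsLatticeMarkoff

variable {p : Fin 3 → ℂ} {s : ℂ} {k : ℤ × ℤ → Fin 3} {ψ : ℤ × ℤ → ℂ} {α : ℝ}

lemma norm_add_le (H : IsLatticeMarkoff p s k ψ) (hα : ∀ i, ‖p i‖ ≤ 2 * α) {u v : ℤ × ℤ}
    (h : Unimod u v) : ‖ψ (u + v)‖ ≤ 2 * α + ‖ψ u‖ * ‖ψ v‖ + ‖ψ (u - v)‖ := by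
  have e : ψ (u + v) = p (k (u + v)) - ψ u * ψ v - ψ (u - v) := by linear_combination H.edge h
  calc ‖ψ (u + v)‖ = ‖p (k (u + v)) - ψ u * ψ v - ψ (u - v)‖ := by rw [← e]
    _ ≤ ‖p (k (u + v)) - ψ u * ψ v‖ + ‖ψ (u - v)‖ := norm_sub_le _ _
    _ ≤ ‖p (k (u + v))‖ + ‖ψ u * ψ v‖ + ‖ψ (u - v)‖ := by gcongr; exact norm_sub_le _ _
    _ ≤ _ := by rw [norm_mul]; gcongr; exact hα _

lemma norm_mul_le (H : IsLatticeMarkoff p s k ψ) (hα : ∀ i, ‖p i‖ ≤ 2 * α) {u v : ℤ × ℤ}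
    (h : Unimod u v) : ‖ψ u‖ * ‖ψ v‖ ≤ 2 * α + ‖ψ (u + v)‖ + ‖ψ (u - v)‖ := by
  have e : ψ u * ψ v = p (k (u + v)) - ψ (u + v) - ψ (u - v) := by linear_combination H.edge h
  calc ‖ψ u‖ * ‖ψ v‖ = ‖p (k (u + v)) - ψ (u + v) - ψ (u - v)‖ := by rw [← e, norm_mul]
    _ ≤ ‖p (k (u + v)) - ψ (u + v)‖ + ‖ψ (u - v)‖ := norm_sub_le _ _
    _ ≤ ‖p (k (u + v))‖ + ‖ψ (u + v)‖ + ‖ψ (u - v)‖ := by gcongr; exact norm_sub_le _ _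
    _ ≤ _ := by gcongr; exact hα _

lemma map_sub_add (H : IsLatticeMarkoff p s k ψ) (u v : ℤ × ℤ) : ψ (u - (u + v)) = ψ v := by
  rw [← H.neg]; congr 1; abel

/-- Upper exponential bound on a cone. -/
lemma norm_le_exp (H : IsLatticeMarkoff p s k ψ) (hα : ∀ i, ‖p i‖ ≤ 2 * α) {F : ℤ × ℤ → ℝ}
    (hF : ∀ u v, F (u + v) = F u + F v) {c : ℝ} (hc3 : 3 ≤ Real.exp c)
    (hcα : 18 * α ≤ Real.exp c) {P Q u : ℤ × ℤ} (hu : Cone P Q u) (h : Unimod P Q)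
    (hP : 1 ≤ F P) (hQ : 1 ≤ F Q) (h1 : ‖ψ P‖ ≤ Real.exp (c * F P) / 3)
    (h2 : ‖ψ Q‖ ≤ Real.exp (c * F Q) / 3) (h3 : ‖ψ (P + Q)‖ ≤ Real.exp (c * F (P + Q)) / 3) :
    ‖ψ u‖ ≤ Real.exp (c * F u) / 3 := by
  have hc0 : 0 < c := by
    by_contra! h0
    have := Real.exp_le_one_iff.2 h0
    linarith
  -- The next value involves `P`, `P + Q` and the difference region `Q`, so the induction carries
  -- the bound at all three of `P`, `Q`, `P + Q`. The factor `1 / 3` turns the product term into a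
  -- ninth, leaving room for `2 * α` and the value at `Q`.
  have step : ∀ {P Q : ℤ × ℤ}, 1 ≤ F P → 1 ≤ F Q → ‖ψ P‖ ≤ Real.exp (c * F P) / 3 →
      ‖ψ Q‖ ≤ Real.exp (c * F Q) / 3 → ‖ψ (P + Q)‖ ≤ Real.exp (c * F (P + Q)) / 3 → Unimod P Q →
      ‖ψ (P + (P + Q))‖ ≤ Real.exp (c * F (P + (P + Q))) / 3 := by
    intro P Q hP hQ h1 h2 h3 h
    have hn := H.norm_add_le hα h.left_add
    rw [H.map_sub_add] at hn
    simp only [hF, mul_add, Real.exp_add] at h3 ⊢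
    have ha : Real.exp c ≤ Real.exp (c * F P) := Real.exp_le_exp.2 (by nlinarith)
    have hb : Real.exp c ≤ Real.exp (c * F Q) := Real.exp_le_exp.2 (by nlinarith)
    set a := Real.exp (c * F P)
    set b := Real.exp (c * F Q)
    have hmul : ‖ψ P‖ * ‖ψ (P + Q)‖ ≤ (a / 3) * (a * b / 3) := by gcongr
    have hab : 9 * b ≤ a * (a * b) := by
      have : 9 ≤ a * a := by nlinarith
      nlinarith
    linarith
  induction hu with
  | left P Q => exact h1
  | right P Q => exact h2
  | @lower P Q u _ ih =>
    exact ih h.left_add hP (by rw [hF]; linarith) h1 h3 (step hP hQ h1 h2 h3 h)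
  | @upper P Q u _ ih =>
    refine ih h.add_right (by rw [hF]; linarith) hQ h3 h2 ?_
    have := step hQ hP h2 h1 (by rwa [add_comm]) h.symm
    rwa [add_comm Q P, add_comm Q] at this

/-- Lower exponential bound on a cone whose initial edge points away from it. -/
lemma exp_le_norm (H : IsLatticeMarkoff p s k ψ) (hα : ∀ i, ‖p i‖ ≤ 2 * α) {T τ c : ℝ}
    (hα0 : 0 ≤ α) (hT : 2 + α < T) (hτ : τ = 1 / 2 - α / T ^ 2) (hτ0 : 0 < τ) (hc : 0 ≤ c)
    {P Q u : ℤ × ℤ} (hu : Cone P Q u) (h : Unimod P Q) (hP : T ≤ ‖ψ P‖) (hQ : T ≤ ‖ψ Q‖)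
    (hPQ : ‖ψ (P - Q)‖ ≤ ‖ψ (P + Q)‖) (h1 : Real.exp (c * norm₁ P) ≤ τ * ‖ψ P‖)
    (h2 : Real.exp (c * norm₁ Q) ≤ τ * ‖ψ Q‖) : Real.exp (c * norm₁ u) ≤ τ * ‖ψ u‖ := by
  have half : ∀ {P Q : ℤ × ℤ}, Unimod P Q → T ≤ ‖ψ P‖ → T ≤ ‖ψ Q‖ →
      ‖ψ (P - Q)‖ ≤ ‖ψ (P + Q)‖ → ‖ψ Q‖ ≤ ‖ψ (P + Q)‖ := by
    intro P Q h hP hQ hPQ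
    have := H.norm_mul_le hα h
    nlinarith
  -- Since the product of moduli is at least `T ^ 2`, the additive constant `α` is absorbed into a
  -- fraction of the product. What remains is `τ |ψ P| |ψ Q| ≤ |ψ (P + Q)|`, so `τ |ψ|` is
  -- supermultiplicative.
  have super : ∀ {P Q : ℤ × ℤ}, Unimod P Q → T ≤ ‖ψ P‖ → T ≤ ‖ψ Q‖ →
      ‖ψ (P - Q)‖ ≤ ‖ψ (P + Q)‖ → Real.exp (c * norm₁ P) ≤ τ * ‖ψ P‖ →
      Real.exp (c * norm₁ Q) ≤ τ * ‖ψ Q‖ →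
      Real.exp (c * norm₁ (P + Q)) ≤ τ * ‖ψ (P + Q)‖ := by
    intro P Q h hP hQ hPQ h1 h2
    have hm := H.norm_mul_le hα h
    have hT0 : 0 < T := by linarith
    have hTT : T ^ 2 ≤ ‖ψ P‖ * ‖ψ Q‖ := by rw [sq]; gcongr
    have hα' : α ≤ α / T ^ 2 * (‖ψ P‖ * ‖ψ Q‖) := by
      rw [div_mul_eq_mul_div, le_div_iff₀ (by positivity)]
      gcongr
    have hle : τ * (‖ψ P‖ * ‖ψ Q‖) ≤ ‖ψ (P + Q)‖ := by
      rw [hτ, sub_mul]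
      linarith
    calc Real.exp (c * norm₁ (P + Q)) ≤ Real.exp (c * norm₁ P) * Real.exp (c * norm₁ Q) := by
          rw [← Real.exp_add, ← mul_add]
          gcongr
          exact norm₁_add_le P Q
      _ ≤ (τ * ‖ψ P‖) * (τ * ‖ψ Q‖) := by gcongr
      _ = τ * (τ * (‖ψ P‖ * ‖ψ Q‖)) := by ring
      _ ≤ _ := mul_le_mul_of_nonneg_left hle hτ0.le
  have next : ∀ {P Q : ℤ × ℤ}, Unimod P Q → T ≤ ‖ψ P‖ → T ≤ ‖ψ Q‖ →
      ‖ψ (P - Q)‖ ≤ ‖ψ (P + Q)‖ → ‖ψ (P - (P + Q))‖ ≤ ‖ψ (P + (P + Q))‖ := by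
    intro P Q h hP hQ hPQ
    have h1 := half h hP hQ hPQ
    have h2 := H.norm_mul_le hα h.left_add
    rw [H.map_sub_add] at h2 ⊢
    have : ‖ψ P‖ * ‖ψ Q‖ ≤ ‖ψ P‖ * ‖ψ (P + Q)‖ := by gcongr
    nlinarith
  have comm : ∀ {P Q : ℤ × ℤ}, ‖ψ (P - Q)‖ ≤ ‖ψ (P + Q)‖ → ‖ψ (Q - P)‖ ≤ ‖ψ (Q + P)‖ := by
    intro P Q h
    rwa [← H.neg (Q - P), neg_sub, add_comm]
  induction hu with
  | left P Q => exact h1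
  | right P Q => exact h2
  | @lower P Q u _ ih =>
    exact ih h.left_add hP (hQ.trans (half h hP hQ hPQ)) (next h hP hQ hPQ) h1
      (super h hP hQ hPQ h1 h2)
  | @upper P Q u _ ih =>
    refine ih h.add_right (hQ.trans (half h hP hQ hPQ)) hQ ?_ (super h hP hQ hPQ h1 h2) h2
    have := comm (next h.symm hQ hP (comm hPQ))
    rwa [add_comm Q P] at this

/-- The product is `T / 2 - α / T`, with `T / 2 > 1 + α / 2` and `α / T ≤ α / 2`. This is where the
threshold `2 + α` makes the normalised moduli exceed `1`. -/
lemma multiplier_pos {T : ℝ} (hα0 : 0 ≤ α) (hT : 2 + α < T) :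
    0 < 1 / 2 - α / T ^ 2 ∧ 1 / 2 - α / T ^ 2 ≤ 1 ∧ 1 < (1 / 2 - α / T ^ 2) * T := by
  have hT0 : 0 < T := by linarith
  have e : (1 / 2 - α / T ^ 2) * T = T / 2 - α / T := by field_simp
  have h1 : 1 < (1 / 2 - α / T ^ 2) * T := by
    rw [e]
    have : α / T ≤ α / 2 := by gcongr; linarith
    linarith
  refine ⟨?_, ?_, h1⟩
  · by_contra! h0
    nlinarith
  · have : 0 ≤ α / T ^ 2 := by positivity
    linarith

end IsLatticeMarkoff

lemma le_posLog_of_exp_le {a τ t : ℝ} (hτ1 : τ ≤ 1) (ht : 0 ≤ t)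
    (h : Real.exp a ≤ τ * t) : a ≤ Real.posLog t := by
  have h1 : Real.exp a ≤ t := h.trans (mul_le_of_le_one_left ht hτ1)
  exact ((Real.le_log_iff_exp_le ((Real.exp_pos a).trans_le h1)).2 h1).trans (le_max_right _ _)


/-! ### Degenerate conics -/

lemma conicDet_eq (p q r s x : ℂ) : conicDet p q r s x =
    (1 - x ^ 2 / 4) * (x ^ 2 - p * x - s) - q ^ 2 / 4 - r ^ 2 / 4 + x * q * r / 4 := by
  simp only [conicDet, Matrix.det_fin_three, Matrix.of_apply, Matrix.cons_val]
  ring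

/-- Up to the factor `-4`, the determinant is a monic quartic in `x`. -/
lemma finite_conicDet (p q r s : ℂ) : {x | conicDet p q r s x = 0}.Finite := by
  open Polynomial in
  let f : ℂ[X] := X ^ 4 + C (-p) * X ^ 3 + C (-s - 4) * X ^ 2 + C (4 * p - q * r) * X +
    C (4 * s + q ^ 2 + r ^ 2)
  have hf : f ≠ 0 := by
    have : f.Monic := by
      simp only [f]
      monicity!
    exact this.ne_zero
  refine (f.finite_setOfPred_isRoot hf).subset fun x hx => ?_
  have hx' : conicDet p q r s x = 0 := hx
  rw [conicDet_eq] at hx'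
  simp only [f, Set.mem_ofPred_eq, Polynomial.IsRoot.def, Polynomial.eval_add, Polynomial.eval_mul,
    Polynomial.eval_pow, Polynomial.eval_X, Polynomial.eval_C]
  linear_combination (-4) * hx'

lemma finite_degenerateSet (p q r s : ℂ) : (degenerateSet p q r s).Finite :=
  ((finite_conicDet p q r s).union
    ((finite_conicDet q p r s).union (finite_conicDet r p q s))).subset fun _ hx => hx

lemma mem_degenerateSet {p q r s x : ℂ} {i j k : Fin 3} (hij : i ≠ j) (hik : i ≠ k) (hjk : j ≠ k)
    (h : conicDet (![p, q, r] i) (![p, q, r] j) (![p, q, r] k) s x = 0) :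
    x ∈ degenerateSet p q r s := by
  have hcomm : ∀ a b c, conicDet a b c s x = conicDet a c b s x := by
    intro a b c
    rw [conicDet_eq, conicDet_eq]; ring
  fin_cases i <;> fin_cases j <;> fin_cases k <;> simp at hij hik hjk <;> simp at h
  · exact Or.inl h
  · exact Or.inl (by rwa [hcomm])
  · exact Or.inr (Or.inl h)
  · exact Or.inr (Or.inl (by rwa [hcomm]))
  · exact Or.inr (Or.inr h)
  · exact Or.inr (Or.inr (by rwa [hcomm]))

lemma le_centreBound {p q r s x : ℂ} (hx : x ∈ degenerateSet p q r s) (h2 : x ≠ 2) (h2' : x ≠ -2)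
    {i j : Fin 3} (hij : i ≠ j) :
    ‖(2 * ![p, q, r] i - x * ![p, q, r] j) / (4 - x ^ 2)‖ ≤ centreBound p q r s := by
  -- Finiteness of the degenerate set supplies the boundedness without which `sSup` would be a
  -- default value.
  refine le_csSup (Set.Finite.bddAbove ?_) ⟨x, hx, h2, h2', i, j, hij, rfl⟩
  refine (((finite_degenerateSet p q r s).prod
    (Set.finite_univ (α := Fin 3 × Fin 3))).image fun z =>
      ‖(2 * ![p, q, r] z.2.1 - z.1 * ![p, q, r] z.2.2) / (4 - z.1 ^ 2)‖).subset ?_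
  rintro t ⟨x, hx, -, -, i, j, -, rfl⟩
  exact ⟨(x, i, j), ⟨hx, trivial⟩, rfl⟩

lemma norm_le_two_mul_alpha (p q r : ℂ) (i : Fin 3) : ‖![p, q, r] i‖ ≤ 2 * alpha p q r := by
  rw [alpha, mul_div_cancel₀ _ two_ne_zero]
  fin_cases i <;> simp

lemma alpha_nonneg (p q r : ℂ) : 0 ≤ alpha p q r := by
  have := (norm_nonneg p).trans (le_max_left ‖p‖ (max ‖q‖ ‖r‖))
  unfold alpha
  positivity

/-! ### Neighbours of a region -/

lemma reg_injective_of_ne_neg {ι : Type*} {f : ι → ℤ × ℤ} (hf : ∀ i, IsCoprime (f i).1 (f i).2)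
    (hneg : ∀ i j, f i ≠ -f j) (hinj : Function.Injective f) :
    Function.Injective fun i => reg (f i) := by
  intro i j hij
  rcases (reg_eq_iff (hf i) (hf j)).1 hij with h | h
  · exact hinj h
  · exact absurd h (hneg i j)

/-- The determinant with `X` is constant along the fan, which excludes opposite vectors; the
determinant with `Y` determines `n`. -/
lemma Unimod.reg_add_zsmul_injective {X Y : ℤ × ℤ} (h : Unimod X Y) :
    Function.Injective fun n : ℤ => reg (Y + n • X) := by
  have hd : det X Y ≠ 0 := by rcases h.cases with h | h <;> rw [h] <;> decide
  have e1 : ∀ n : ℤ, det X (Y + n • X) = det X Y := by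
    intro n
    simp only [det, Prod.fst_add, Prod.snd_add, Prod.smul_fst, Prod.smul_snd, smul_eq_mul]
    ring
  have e2 : ∀ n : ℤ, det (Y + n • X) Y = n * det X Y := by
    intro n
    simp only [det, Prod.fst_add, Prod.snd_add, Prod.smul_fst, Prod.smul_snd, smul_eq_mul]
    ring
  refine reg_injective_of_ne_neg (f := fun n : ℤ => Y + n • X)
    (fun n => (h.add_zsmul n).symm.isCoprime) (fun n m hnm => ?_) fun n m hnm => ?_
  · have h1 := e1 n
    have hnm' : Y + n • X = -(Y + m • X) := hnm
    rw [hnm', det_neg_right, e1] at h1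
    omega
  · have h1 := e2 n
    have hnm' : Y + n • X = Y + m • X := hnm
    rw [hnm', e2] at h1
    exact (mul_right_cancel₀ hd h1).symm

/-- The values of a Markoff map around a region whose value is not in `[-2, 2]` grow exponentially
in each direction. -/
lemma IsLatticeMarkoff.eventually_pow_le_norm {p q r s : ℂ} {k : ℤ × ℤ → Fin 3} {φ : Region → ℂ}
    (H : IsLatticeMarkoff ![p, q, r] s k (fun u => φ (reg u)))
    (hx : ∀ X, φ X ∉ ((fun t : ℝ => (t : ℂ)) '' Set.Icc (-2) 2))
    (hfin : {X | ‖φ X‖ ≤ centreBound p q r s + 1}.Finite) {X Y : ℤ × ℤ} (h : Unimod X Y) :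
    ∃ ρ c : ℝ, 1 < ρ ∧ 0 < c ∧
      ∀ᶠ n : ℕ in atTop, c * ρ ^ n ≤ ‖φ (reg (Y + (n : ℤ) • X))‖ := by
  obtain ⟨l, hl, hlx⟩ := exists_multiplier (hx (reg X))
  set x := φ (reg X) with hxdef
  have h2 : x ≠ 2 := fun h2 => hx (reg X) ⟨2, by norm_num, by rw [← hxdef, h2]; norm_num⟩
  have h2' : x ≠ -2 := fun h2 => hx (reg X) ⟨-2, by norm_num, by rw [← hxdef, h2]; norm_num⟩
  have h4 : 4 - x ^ 2 ≠ 0 := by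
    intro h0
    have : (2 - x) * (2 + x) = 0 := by linear_combination h0
    rcases mul_eq_zero.1 this with h' | h'
    · exact h2 (by linear_combination -h')
    · exact h2' (by linear_combination h')
  let y : ℤ → ℂ := fun n => φ (reg (Y + n • X))
  let γ : ℤ → ℂ := fun n => ![p, q, r] (k (Y + n • X))
  -- The constants `γ` have period two, and `η` is the two-periodic particular solution of the
  -- recurrence: its values are the coordinates of the centre of the conic. Subtracting it leaves a
  -- homogeneous recurrence.
  let η : ℤ → ℂ := fun n => (2 * γ n - x * γ (n + 1)) / (4 - x ^ 2)
  have hsucc : ∀ n : ℤ, Y + n • X + X = Y + (n + 1) • X := fun n => by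
    rw [add_smul, one_smul, add_assoc]
  have hpred : ∀ n : ℤ, Y + n • X - X = Y + (n - 1) • X := fun n => by
    rw [sub_smul, one_smul, add_sub_assoc]
  have hyrec : ∀ n, y (n + 1) + y (n - 1) = γ (n + 1) - y n * x := by
    intro n
    have := H.edge (h.add_zsmul n).symm
    simpa only [hsucc, hpred] using this
  have hγ1 : ∀ n, γ (n + 1) = γ (n - 1) := by
    intro n
    have := H.color_add (h.add_zsmul n).symm
    rw [hsucc, hpred] at this
    simp only [γ, this]
  have hη : ∀ n, η (n + 1) = (2 * γ (n + 1) - x * γ n) / (4 - x ^ 2) := by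
    intro n
    have := hγ1 (n + 1)
    rw [add_sub_cancel_right] at this
    simp only [η, this]
  have hη' : ∀ n, η (n - 1) = (2 * γ (n + 1) - x * γ n) / (4 - x ^ 2) := by
    intro n
    simp only [η, sub_add_cancel, hγ1 n]
  let w : ℤ → ℂ := fun n => y n - η n
  have hw : ∀ n, w (n + 1) + w (n - 1) = (l + l⁻¹) * w n := by
    intro n
    rw [hlx]
    have e : η (n + 1) + η (n - 1) + x * η n = γ (n + 1) := by
      rw [hη, hη']
      simp only [η]
      field_simp
      ring
    simp only [w]
    linear_combination hyrec n - e
  obtain ⟨A, B, hAB, hQ⟩ := exists_eq_zpow_add_zpow hl hw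
  have hbound : ∃ K : ℝ, ∀ n, ‖η n‖ ≤ K := by
    refine ⟨(2 * (2 * alpha p q r) + ‖x‖ * (2 * alpha p q r)) / ‖4 - x ^ 2‖, fun n => ?_⟩
    simp only [η]
    rw [norm_div]
    gcongr
    refine (norm_sub_le _ _).trans ?_
    rw [norm_mul, norm_mul, Complex.norm_ofNat]
    gcongr <;> exact norm_le_two_mul_alpha p q r _
  obtain ⟨K, hK⟩ := hbound
  have hA : A ≠ 0 := by
    rintro rfl
    have hcol : ∀ n : ℤ, k (Y + n • X) ≠ k (Y + (n + 1) • X) := by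
      intro n
      have := H.color_ne (h.add_zsmul n).symm.left_add
      rwa [hsucc] at this
    -- Recentred at `η`, the vertex relation is the quadratic form in `w 0`, `w 1` plus a constant,
    -- namely the determinant divided by `1 - x ^ 2 / 4`. With `A = 0` the form vanishes, hence so
    -- does the determinant.
    have hdet : conicDet (![p, q, r] (k X)) (γ 0) (γ 1) s x = 0 := by
      have hv := H.vertex h.symm
      have e0 : y 0 = φ (reg Y) := by simp [y]
      have e1 : y 1 = φ (reg (Y + X)) := by simp [y]
      have g0 : γ 0 = ![p, q, r] (k Y) := by simp [γ]
      have g1 : γ 1 = ![p, q, r] (k (Y + X)) := by simp [γ]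
      rw [← e0, ← e1, ← g0, ← g1, ← hxdef] at hv
      have w0 : (4 - x ^ 2) * w 0 = (4 - x ^ 2) * y 0 - (2 * γ 0 - x * γ 1) := by
        simp only [w, η]
        field_simp
        simp
      have w1 : (4 - x ^ 2) * w 1 = (4 - x ^ 2) * y 1 - (2 * γ 1 - x * γ 0) := by
        have := hη 0
        rw [zero_add] at this
        simp only [w, this]
        field_simp
      rw [hlx] at hQ
      have hQ0 : w 0 ^ 2 + w 1 ^ 2 + x * w 0 * w 1 = 0 := by linear_combination hQ
      have hQ1 : ((4 - x ^ 2) * w 0) ^ 2 + ((4 - x ^ 2) * w 1) ^ 2 +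
          x * ((4 - x ^ 2) * w 0) * ((4 - x ^ 2) * w 1) = 0 := by
        linear_combination (4 - x ^ 2) ^ 2 * hQ0
      rw [w0, w1] at hQ1
      refine (mul_eq_zero.1 (?_ : (4 - x ^ 2) * _ = 0)).resolve_left h4
      rw [conicDet_eq]
      linear_combination (-1 / 4 : ℂ) * hQ1 + (1 / 4) * (4 - x ^ 2) ^ 2 * hv
    have hmem : x ∈ degenerateSet p q r s := by
      refine mem_degenerateSet (H.color_ne (h.add_zsmul 0)) (H.color_ne (h.add_zsmul 1)) ?_ hdet
      simpa using hcol 0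
    -- Infinitely many neighbours then lie within `1` of the centre coordinates, hence have modulus
    -- at most `M + 1`.
    have hinf := infinite_norm_le_one (B := B) hl (zero_mul B)
    refine (hinf.image (h.reg_add_zsmul_injective.injOn)) (hfin.subset ?_)
    rintro _ ⟨n, hn, rfl⟩
    have hn' : ‖w n‖ ≤ 1 := by rw [hAB]; exact hn
    have hc : ‖η n‖ ≤ centreBound p q r s := le_centreBound hmem h2 h2' (hcol n)
    have : ‖y n‖ ≤ ‖w n‖ + ‖η n‖ := by
      have := _root_.norm_add_le (w n) (η n)
      rwa [show w n + η n = y n by simp [w]] at this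
    show ‖y n‖ ≤ _
    linarith
  obtain ⟨c, hc, hev⟩ := MarkoffFarey.eventually_pow_le_norm (B := B) hl hA K
  refine ⟨‖l‖, c, hl, hc, hev.mono fun n hn => ?_⟩
  rw [← hAB] at hn
  have h1 := norm_sub_le (y n) (η n)
  have h2 := hK n
  have h3 : ‖w n‖ = ‖y n - η n‖ := rfl
  show _ ≤ ‖y n‖
  linarith


/-! ### Infinite descent -/

/-- Two sequences of moduli, one of which decreases at each step of a descending path, can only
converge to `2`. -/
lemma tendsto_two_of_descent {α : ℝ} (hα : 0 ≤ α) {a b : ℕ → ℝ} (ha : ∀ n, 2 + α ≤ a n)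
    (hb : ∀ n, 2 + α ≤ b n) {l r : ℕ → Prop} (hlr : ∀ n, l n ∨ r n)
    (hl : ∀ n, l n → a (n + 1) = a n ∧ a n * b (n + 1) ≤ 2 * α + 2 * b n)
    (hr : ∀ n, r n → b (n + 1) = b n ∧ b n * a (n + 1) ≤ 2 * α + 2 * a n)
    (hfl : ∃ᶠ n in atTop, l n) (hfr : ∃ᶠ n in atTop, r n) :
    α = 0 ∧ Tendsto a atTop (𝓝 2) ∧ Tendsto b atTop (𝓝 2) := by
  have anti : ∀ {x y z : ℝ}, 2 + α ≤ x → 2 + α ≤ y → x * y ≤ 2 * α + 2 * z → y ≤ z := by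
    intro x y z hx hy h
    nlinarith
  have haa : Antitone a := antitone_nat_of_succ_le fun n => by
    rcases hlr n with h | h
    · exact (hl n h).1.le
    · exact anti (hb n) (ha _) (hr n h).2
  have hbb : Antitone b := antitone_nat_of_succ_le fun n => by
    rcases hlr n with h | h
    · exact anti (ha n) (hb _) (hl n h).2
    · exact (hr n h).1.le
  have hat := tendsto_atTop_ciInf haa ⟨2 + α, by rintro _ ⟨n, rfl⟩; exact ha n⟩
  have hbt := tendsto_atTop_ciInf hbb ⟨2 + α, by rintro _ ⟨n, rfl⟩; exact hb n⟩
  set A := ⨅ n, a n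
  set B := ⨅ n, b n
  have hA : 2 + α ≤ A := ge_of_tendsto' hat ha
  have hB : 2 + α ≤ B := ge_of_tendsto' hbt hb
  have hat' := hat.comp (tendsto_add_atTop_nat 1)
  have hbt' := hbt.comp (tendsto_add_atTop_nat 1)
  -- Each inequality is available only at steps of one kind; since both kinds recur, both survive in
  -- the limit. Together with `A, B ≥ 2 + α` they leave only `α = 0`, `A = B = 2`.
  have h1 : A * B - (2 * α + 2 * B) ≤ 0 :=
    le_of_tendsto_of_frequently ((hat.mul hbt').sub ((hbt.const_mul 2).const_add (2 * α)))
      (hfl.mono fun n hn => sub_nonpos.2 (hl n hn).2)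
  have h2 : B * A - (2 * α + 2 * A) ≤ 0 :=
    le_of_tendsto_of_frequently ((hbt.mul hat').sub ((hat.const_mul 2).const_add (2 * α)))
      (hfr.mono fun n hn => sub_nonpos.2 (hr n hn).2)
  have hα0 : α = 0 := by nlinarith
  have hA2 : A = 2 := by nlinarith
  have hB2 : B = 2 := by nlinarith
  exact ⟨hα0, hA2 ▸ hat, hB2 ▸ hbt⟩

namespace IsLatticeMarkoff

variable {p : Fin 3 → ℂ} {s : ℂ} {k : ℤ × ℤ → Fin 3} {ψ : ℤ × ℤ → ℂ} {α : ℝ}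

/-- A path of mediants along which the values decrease forever, without turning around a single
region, forces the Markoff map to be a `(0, 0, 0, 4)`-Markoff map with values tending to `2`. -/
lemma eq_four_of_descent (H : IsLatticeMarkoff p s k ψ) (hα : ∀ i, ‖p i‖ ≤ 2 * α) (hα0 : 0 ≤ α)
    {P Q : ℕ → ℤ × ℤ} (hu : ∀ n, Unimod (P n) (Q n)) {l r : ℕ → Prop} (hlr : ∀ n, l n ∨ r n)
    (hl : ∀ n, l n → P (n + 1) = P n ∧ Q (n + 1) = P n + Q n)
    (hr : ∀ n, r n → P (n + 1) = P n + Q n ∧ Q (n + 1) = Q n)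
    (hfl : ∃ᶠ n in atTop, l n) (hfr : ∃ᶠ n in atTop, r n)
    (hP : ∀ n, 2 + α ≤ ‖ψ (P n)‖) (hQ : ∀ n, 2 + α ≤ ‖ψ (Q n)‖)
    (hdesc : ∀ n, ‖ψ (P n + Q n)‖ ≤ ‖ψ (P n - Q n)‖) :
    α = 0 ∧ s = 4 ∧ Tendsto (fun n => ‖ψ (P n)‖) atTop (𝓝 2) := by
  have hl' : ∀ n, l n → ψ (P (n + 1) - Q (n + 1)) = ψ (Q n) := fun n hn => by
    rw [(hl n hn).1, (hl n hn).2, H.map_sub_add]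
  have hr' : ∀ n, r n → ψ (P (n + 1) - Q (n + 1)) = ψ (P n) := fun n hn => by
    rw [(hr n hn).1, (hr n hn).2, add_sub_cancel_right]
  obtain ⟨h0, hat, hbt⟩ := tendsto_two_of_descent hα0 hP hQ hlr (l := l) (r := r)
    (fun n hn => by
      have h1 := H.norm_mul_le hα (hu (n + 1))
      have h2 := hdesc (n + 1)
      rw [hl' n hn] at h1 h2
      rw [(hl n hn).1] at h1 h2 ⊢
      exact ⟨rfl, by linarith⟩)
    (fun n hn => by
      have h1 := H.norm_mul_le hα (hu (n + 1))
      have h2 := hdesc (n + 1)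
      rw [hr' n hn] at h1 h2
      rw [(hr n hn).2] at h1 h2 ⊢
      exact ⟨rfl, by linarith⟩) hfl hfr
  refine ⟨h0, ?_, hat⟩
  subst h0
  have hp : ∀ i, p i = 0 := fun i => norm_le_zero_iff.1 (by simpa using hα i)
  have hat1 := hat.comp (tendsto_add_atTop_nat 1)
  have hbt1 := hbt.comp (tendsto_add_atTop_nat 1)
  -- the two regions at the ends of the edges also have values of modulus tending to `2`
  have hzt : Tendsto (fun n => ‖ψ (P n + Q n)‖) atTop (𝓝 2) := by
    have h1 := hat1.min hbt1
    have h2 := hat1.max hbt1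
    rw [min_self] at h1
    rw [max_self] at h2
    refine tendsto_of_tendsto_of_tendsto_of_le_of_le h1 h2 (fun n => ?_) fun n => ?_ <;>
      rcases hlr n with h | h
    · simp [← (hl n h).2]
    · simp [← (hr n h).1]
    · simp [← (hl n h).2]
    · simp [← (hr n h).1]
  have hz't : Tendsto (fun n => ‖ψ (P n - Q n)‖) atTop (𝓝 2) := by
    rw [← tendsto_add_atTop_iff_nat 1]
    have h1 := hat.min hbt
    have h2 := hat.max hbt
    rw [min_self] at h1
    rw [max_self] at h2
    refine tendsto_of_tendsto_of_tendsto_of_le_of_le h1 h2 (fun n => ?_) fun n => ?_ <;>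
      rcases hlr n with h | h
    · simp [hl' n h]
    · simp [hr' n h]
    · simp [hl' n h]
    · simp [hr' n h]
  obtain ⟨d, hd⟩ : ∃ d : ℕ → ℂ, ∀ n, d n = ψ (P n + Q n) - ψ (P n - Q n) := ⟨_, fun _ => rfl⟩
  have hedge : ∀ n, ψ (P n + Q n) + ψ (P n - Q n) = -(ψ (P n) * ψ (Q n)) := fun n => by
    rw [H.edge (hu n), hp, zero_sub]
  -- By the parallelogram law, `‖d n‖ ^ 2` tends to `2 * (4 + 4) - 4 ^ 2 = 0`: the two end values
  -- become equal.
  have hdt : Tendsto (fun n => ‖d n‖ ^ 2) atTop (𝓝 0) := by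
    have e : ∀ n, ‖d n‖ ^ 2 = 2 * (‖ψ (P n + Q n)‖ ^ 2 + ‖ψ (P n - Q n)‖ ^ 2) -
        (‖ψ (P n)‖ * ‖ψ (Q n)‖) ^ 2 := by
      intro n
      have h := parallelogram_law_with_norm ℝ (ψ (P n + Q n)) (ψ (P n - Q n))
      rw [hedge, ← hd, norm_neg, norm_mul] at h
      linarith
    simp only [e]
    have := (((hzt.pow 2).add (hz't.pow 2)).const_mul 2).sub ((hat.mul hbt).pow 2)
    norm_num at this
    exact this
  have hdt1 : Tendsto (fun n => ‖d n‖) atTop (𝓝 0) := by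
    have := hdt.sqrt
    simpa using this
  have hdt2 := hdt1.comp (tendsto_add_atTop_nat 1)
  have hlim : Tendsto (fun n => ‖d n‖ ^ 2 + (2 * ‖d (n + 1)‖ + ‖ψ (P n)‖ * ‖d n‖) / 2 *
      (‖ψ (Q n)‖ ^ 2 + 4)) atTop (𝓝 (0 + (2 * 0 + 2 * 0) / 2 * (2 ^ 2 + 4))) :=
    hdt.add ((((hdt2.const_mul 2).add (hat.mul hdt1)).div_const 2).mul
      ((hbt.pow 2).add_const 4))
  have hle : 4 * ‖4 - s‖ ≤ 0 + (2 * 0 + 2 * 0) / 2 * (2 ^ 2 + 4) := by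
    refine ge_of_tendsto_of_frequently hlim (hfl.mono fun n hn => ?_)
    have hv := H.vertex (hu n)
    simp only [hp, zero_mul, zero_add] at hv
    -- Here `d n ^ 2` is the discriminant of the vertex relation as a quadratic in the third value.
    -- As `d n → 0`, it remains to see that `ψ (P n) ^ 2 → 4` along the steps fixing `P n`, which
    -- `e2` gives.
    have e1 : 4 * (4 - s) =
        (ψ (P n) ^ 2 - 4) * (ψ (Q n) ^ 2 - 4) - d n ^ 2 := by
      rw [hd]
      have := hedge n
      have hz : ψ (P n - Q n) = -(ψ (P n) * ψ (Q n)) - ψ (P n + Q n) := by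
        linear_combination this
      rw [hz]
      linear_combination (4 : ℂ) * hv
    have e2 : (ψ (P n) ^ 2 - 4) * ψ (Q n) = 2 * d (n + 1) + ψ (P n) * d n := by
      have h1 := hedge n
      have h2 := hedge (n + 1)
      have h3 := hl' n hn
      rw [hd, hd, h3]
      rw [h3, (hl n hn).1, (hl n hn).2] at h2
      rw [(hl n hn).1, (hl n hn).2]
      linear_combination (-2) * h2 + ψ (P n) * h1
    have n2 : ‖ψ (P n) ^ 2 - 4‖ ≤ (2 * ‖d (n + 1)‖ + ‖ψ (P n)‖ * ‖d n‖) / 2 := by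
      have h1 : ‖ψ (P n) ^ 2 - 4‖ * ‖ψ (Q n)‖ ≤ 2 * ‖d (n + 1)‖ + ‖ψ (P n)‖ * ‖d n‖ := by
        rw [← norm_mul, e2]
        refine (_root_.norm_add_le _ _).trans ?_
        rw [norm_mul, norm_mul, Complex.norm_ofNat]
      have h2 := hQ n
      have h3 := norm_nonneg (ψ (P n) ^ 2 - 4)
      nlinarith
    have n3 : ‖ψ (Q n) ^ 2 - 4‖ ≤ ‖ψ (Q n)‖ ^ 2 + 4 := by
      refine (norm_sub_le _ _).trans ?_
      rw [norm_pow, Complex.norm_ofNat]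
    calc 4 * ‖4 - s‖ = ‖4 * (4 - s)‖ := by rw [norm_mul, Complex.norm_ofNat]
      _ = ‖(ψ (P n) ^ 2 - 4) * (ψ (Q n) ^ 2 - 4) - d n ^ 2‖ := by rw [e1]
      _ ≤ ‖ψ (P n) ^ 2 - 4‖ * ‖ψ (Q n) ^ 2 - 4‖ + ‖d n‖ ^ 2 := by
          refine (norm_sub_le _ _).trans ?_
          rw [norm_mul, norm_pow]
      _ ≤ (2 * ‖d (n + 1)‖ + ‖ψ (P n)‖ * ‖d n‖) / 2 * (‖ψ (Q n)‖ ^ 2 + 4) + ‖d n‖ ^ 2 := by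
          gcongr
      _ = _ := add_comm _ _
  have : ‖4 - s‖ = 0 := by
    have := norm_nonneg (4 - s)
    linarith
  exact (sub_eq_zero.1 (norm_eq_zero.1 this)).symm

end IsLatticeMarkoff

/-! ### Lower bounds on cones -/

/-- A lower bound for `f`, linear in the norm, up to finitely many primitive vectors of a cone. -/
def HasLinearLowerBound (f : ℤ × ℤ → ℝ) (P Q : ℤ × ℤ) : Prop :=
  ∃ c : ℝ, 0 < c ∧ {u | Cone P Q u ∧ ¬ c * norm₁ u ≤ f u}.Finite

namespace HasLinearLowerBound

variable {f : ℤ × ℤ → ℝ} {P Q : ℤ × ℤ}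

lemma symm (h : HasLinearLowerBound f P Q) : HasLinearLowerBound f Q P := by
  obtain ⟨c, hc, hf⟩ := h
  exact ⟨c, hc, hf.subset fun u hu => ⟨hu.1.symm, hu.2⟩⟩

/-- A cone is the union of its two subcones and its generators, and the latter may join the finite
exceptional set. -/
lemma of_children (h1 : HasLinearLowerBound f P (P + Q)) (h2 : HasLinearLowerBound f (P + Q) Q) :
    HasLinearLowerBound f P Q := by
  obtain ⟨c, hc, hf⟩ := h1
  obtain ⟨c', hc', hf'⟩ := h2
  refine ⟨min c c', lt_min hc hc', ((hf.union hf').union (Set.toFinite {P, Q})).subset ?_⟩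
  rintro u ⟨hu, hn⟩
  have hn1 : ¬ c * norm₁ u ≤ f u := fun h =>
    hn ((mul_le_mul_of_nonneg_right (min_le_left _ _) (norm₁_nonneg u)).trans h)
  have hn2 : ¬ c' * norm₁ u ≤ f u := fun h =>
    hn ((mul_le_mul_of_nonneg_right (min_le_right _ _) (norm₁_nonneg u)).trans h)
  cases hu with
  | left => exact Or.inr (Or.inl rfl)
  | right => exact Or.inr (Or.inr rfl)
  | lower h => exact Or.inl (Or.inl ⟨h, hn1⟩)
  | upper h => exact Or.inl (Or.inr ⟨h, hn2⟩)

end HasLinearLowerBound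

namespace IsLatticeMarkoff

variable {p : Fin 3 → ℂ} {s : ℂ} {k : ℤ × ℤ → Fin 3} {ψ : ℤ × ℤ → ℂ} {α : ℝ}

/-- An edge whose larger end lies inside the cone starts growth in all of it, with no exceptions.
The constant `c` is small enough for the exponential bound to hold at both generators. -/
lemma hasLinearLowerBound_of_outward (H : IsLatticeMarkoff p s k ψ) (hα : ∀ i, ‖p i‖ ≤ 2 * α)
    (hα0 : 0 ≤ α) {P Q : ℤ × ℤ} (h : Unimod P Q) (hP : 2 + α < ‖ψ P‖) (hQ : 2 + α < ‖ψ Q‖)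
    (hPQ : ‖ψ (P - Q)‖ ≤ ‖ψ (P + Q)‖) : HasLinearLowerBound (fun u => Real.posLog ‖ψ u‖) P Q := by
  obtain ⟨T, hT⟩ : ∃ T, T = min ‖ψ P‖ ‖ψ Q‖ := ⟨_, rfl⟩
  have hT2 : 2 + α < T := hT ▸ lt_min hP hQ
  have hTP : T ≤ ‖ψ P‖ := hT ▸ min_le_left _ _
  have hTQ : T ≤ ‖ψ Q‖ := hT ▸ min_le_right _ _
  obtain ⟨hτ0, hτ1, hτT⟩ := multiplier_pos hα0 hT2
  set τ := 1 / 2 - α / T ^ 2 with hτ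
  have hn1 := norm₁_nonneg P
  have hn2 := norm₁_nonneg Q
  have hlog : 0 < Real.log (τ * T) := Real.log_pos hτT
  obtain ⟨c, hc⟩ : ∃ c, c = Real.log (τ * T) / (norm₁ P + norm₁ Q + 1) := ⟨_, rfl⟩
  have hc0 : 0 < c := by rw [hc]; positivity
  have hcT : c * (norm₁ P + norm₁ Q + 1) = Real.log (τ * T) := by
    rw [hc]; field_simp
  have base : ∀ {u : ℤ × ℤ}, norm₁ u ≤ norm₁ P + norm₁ Q + 1 → T ≤ ‖ψ u‖ →
      Real.exp (c * norm₁ u) ≤ τ * ‖ψ u‖ := by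
    intro u h1 h2
    calc Real.exp (c * norm₁ u) ≤ Real.exp (c * (norm₁ P + norm₁ Q + 1)) := by gcongr
      _ = τ * T := by rw [hcT, Real.exp_log (by linarith)]
      _ ≤ _ := by gcongr
  refine ⟨c, hc0, Set.Finite.subset Set.finite_empty ?_⟩
  rintro u ⟨hu, hn⟩
  exact hn (le_posLog_of_exp_le hτ1 (norm_nonneg _) (H.exp_le_norm hα hα0 hT2 hτ hτ0 hc0.le hu h
    hTP hTQ hPQ (base (by linarith) hTP) (base (by linarith) hTQ)))

/-- Exponential growth of the neighbours of a region gives a lower bound beyond one of them. -/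
lemma exists_hasLinearLowerBound_fan (H : IsLatticeMarkoff p s k ψ) (hα : ∀ i, ‖p i‖ ≤ 2 * α)
    (hα0 : 0 ≤ α) {X Y : ℤ × ℤ} (h : Unimod X Y) {ρ c : ℝ} (hρ : 1 < ρ) (hc : 0 < c)
    (hgrow : ∀ᶠ n : ℕ in atTop, c * ρ ^ n ≤ ‖ψ (Y + (n : ℤ) • X)‖) :
    ∃ N : ℕ, ∀ n : ℕ, N ≤ n →
      HasLinearLowerBound (fun u => Real.posLog ‖ψ u‖) X (Y + (n : ℤ) • X) := by
  -- No lower bound on `‖ψ X‖` is assumed, so growth cannot start from an edge at `X`. The threshold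
  -- exceeds `‖ψ X‖` so that, for a far neighbour `Z`, the edge between `X + Z` and `Z` points away
  -- from `X`.
  obtain ⟨T, hT⟩ : ∃ T, T = 3 + α + ‖ψ X‖ := ⟨_, rfl⟩
  have hX := norm_nonneg (ψ X)
  have hT2 : 2 + α < T := by linarith
  obtain ⟨hτ0, hτ1, hτT⟩ := multiplier_pos hα0 hT2
  set τ := 1 / 2 - α / T ^ 2 with hτ
  -- One factor `√ρ ^ n` pays for the constant `τ * c`, the other for the exponential of the norm.
  have hσ : 1 < √ρ := by rwa [Real.lt_sqrt zero_le_one, one_pow]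
  have hσρ : √ρ * √ρ = ρ := Real.mul_self_sqrt (by linarith)
  have hn1 := norm₁_nonneg X
  have hn2 := norm₁_nonneg Y
  have hlog : 0 < Real.log √ρ := Real.log_pos hσ
  obtain ⟨d, hd⟩ : ∃ d, d = Real.log √ρ / (norm₁ X + norm₁ Y + 1) := ⟨_, rfl⟩
  have hd0 : 0 < d := by rw [hd]; positivity
  have hdT : d * (norm₁ X + norm₁ Y + 1) = Real.log √ρ := by
    rw [hd]; field_simp
  have e1 := (tendsto_pow_atTop_atTop_of_one_lt hρ).eventually_ge_atTop (T / c)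
  have e2 := (tendsto_pow_atTop_atTop_of_one_lt hσ).eventually_ge_atTop (1 / (τ * c))
  obtain ⟨N, hN⟩ := eventually_atTop.1 (hgrow.and (e1.and (e2.and (eventually_ge_atTop 1))))
  have key : ∀ n : ℕ, N ≤ n → T ≤ ‖ψ (Y + (n : ℤ) • X)‖ ∧
      Real.exp (d * norm₁ (Y + (n : ℤ) • X)) ≤ τ * ‖ψ (Y + (n : ℤ) • X)‖ := by
    intro n hn
    obtain ⟨h1, h2, h3, h4⟩ := hN n hn
    rw [div_le_iff₀ (by positivity)] at h2 h3
    refine ⟨by linarith, ?_⟩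
    have h4' : (1 : ℝ) ≤ n := by exact_mod_cast h4
    have hnorm : norm₁ (Y + (n : ℤ) • X) ≤ n * (norm₁ X + norm₁ Y + 1) := by
      refine (norm₁_add_le _ _).trans ?_
      rw [norm₁_smul, Int.cast_natCast, Nat.abs_cast]
      nlinarith
    calc Real.exp (d * norm₁ (Y + (n : ℤ) • X))
        ≤ Real.exp (d * (n * (norm₁ X + norm₁ Y + 1))) := by gcongr
      _ = (√ρ) ^ n := by
          rw [mul_left_comm, hdT, Real.exp_nat_mul, Real.exp_log (by linarith)]
      _ ≤ √ρ ^ n * (√ρ ^ n * (τ * c)) := le_mul_of_one_le_right (by positivity) h3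
      _ = τ * (c * ρ ^ n) := by
          have : ρ ^ n = √ρ ^ n * √ρ ^ n := by rw [← mul_pow, hσρ]
          rw [this]; ring
      _ ≤ _ := by gcongr
  have hsucc : ∀ n : ℕ, X + (Y + (n : ℤ) • X) = Y + ((n + 1 : ℕ) : ℤ) • X := fun n => by
    push_cast
    rw [add_smul, one_smul]
    abel
  -- The lower subcone is the next cone of the fan at `X`, and the upper one starts at an outward
  -- edge. Only `X` itself escapes the bound.
  have main : ∀ {P Q u : ℤ × ℤ}, Cone P Q u → ∀ n : ℕ, N ≤ n → P = X → Q = Y + (n : ℤ) • X →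
      u = X ∨ Real.exp (d * norm₁ u) ≤ τ * ‖ψ u‖ := by
    intro P Q u hu
    induction hu with
    | left P Q => exact fun n hn hP hQ => Or.inl hP
    | right P Q =>
      rintro n hn rfl rfl
      exact Or.inr (key n hn).2
    | lower _ ih =>
      rintro n hn rfl rfl
      exact ih (n + 1) (by omega) rfl (hsucc n)
    | @upper P Q u hu _ =>
      rintro n hn rfl rfl
      right
      obtain ⟨k1, k2⟩ := key n hn
      obtain ⟨k3, k4⟩ := key (n + 1) (by omega)
      have hU := h.add_zsmul n
      rw [← hsucc] at k3 k4
      set Z := Y + (n : ℤ) • P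
      refine H.exp_le_norm hα hα0 hT2 hτ hτ0 hd0.le hu hU.add_right k3 k1 ?_ k4 k2
      have h1 := H.norm_mul_le hα hU.add_right
      rw [add_sub_cancel_right] at h1 ⊢
      nlinarith
  refine ⟨N, fun n hn => ⟨d, hd0, (Set.finite_singleton X).subset ?_⟩⟩
  rintro u ⟨hu, hlt⟩
  exact (main hu n hn rfl rfl).resolve_right fun h' =>
    hlt (le_posLog_of_exp_le hτ1 (norm_nonneg _) h')

end IsLatticeMarkoff


/-- Contrapositive of `of_children`: one subcone inherits the failure, and the choice is iterated.
-/
lemma HasLinearLowerBound.exists_path {f : ℤ × ℤ → ℝ} {P Q : ℤ × ℤ}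
    (h : ¬ HasLinearLowerBound f P Q) :
    ∃ A B : ℕ → ℤ × ℤ, A 0 = P ∧ B 0 = Q ∧ (∀ n, ¬ HasLinearLowerBound f (A n) (B n)) ∧
      ∀ n, (A (n + 1) = A n ∧ B (n + 1) = A n + B n) ∨
        (A (n + 1) = A n + B n ∧ B (n + 1) = B n) := by
  have step : ∀ z : {z : (ℤ × ℤ) × (ℤ × ℤ) // ¬ HasLinearLowerBound f z.1 z.2},
      ∃ z' : {z : (ℤ × ℤ) × (ℤ × ℤ) // ¬ HasLinearLowerBound f z.1 z.2},
        (z'.1.1 = z.1.1 ∧ z'.1.2 = z.1.1 + z.1.2) ∨ (z'.1.1 = z.1.1 + z.1.2 ∧ z'.1.2 = z.1.2) := by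
    rintro ⟨⟨P, Q⟩, hz⟩
    by_cases h1 : HasLinearLowerBound f P (P + Q)
    · exact ⟨⟨(P + Q, Q), fun h2 => hz (h1.of_children h2)⟩, Or.inr ⟨rfl, rfl⟩⟩
    · exact ⟨⟨(P, P + Q), h1⟩, Or.inl ⟨rfl, rfl⟩⟩
  choose g hg using step
  refine ⟨fun n => (g^[n] ⟨(P, Q), h⟩).1.1, fun n => (g^[n] ⟨(P, Q), h⟩).1.2, rfl, rfl,
    fun n => (g^[n] ⟨(P, Q), h⟩).2, fun n => ?_⟩
  simp only [Function.iterate_succ_apply']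
  exact hg _

section Path

variable {A B : ℕ → ℤ × ℤ}

lemma unimod_path (h0 : Unimod (A 0) (B 0))
    (hstep : ∀ n, (A (n + 1) = A n ∧ B (n + 1) = A n + B n) ∨
      (A (n + 1) = A n + B n ∧ B (n + 1) = B n)) (n : ℕ) : Unimod (A n) (B n) := by
  induction n with
  | zero => exact h0
  | succ n ih =>
    rcases hstep n with ⟨h1, h2⟩ | ⟨h1, h2⟩ <;> rw [h1, h2]
    exacts [ih.left_add, ih.add_right]

/-- The regions successively met by a path in the tree are distinct. -/
lemma reg_add_path_injective (h0 : Unimod (A 0) (B 0))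
    (hstep : ∀ n, (A (n + 1) = A n ∧ B (n + 1) = A n + B n) ∨
      (A (n + 1) = A n + B n ∧ B (n + 1) = B n)) :
    Function.Injective fun n => reg (A n + B n) := by
  -- The coordinate sum in the initial basis: additive, positive along the path, and strictly
  -- increasing on mediants.
  obtain ⟨F, hF⟩ : ∃ F : ℤ × ℤ → ℤ,
      ∀ u, F u = det (A 0) (B 0) * (det u (B 0) + det (A 0) u) := ⟨_, fun _ => rfl⟩
  have hadd : ∀ u v, F (u + v) = F u + F v := by
    intro u v
    simp only [hF, det, Prod.fst_add, Prod.snd_add]; ring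
  have hneg : ∀ u, F (-u) = - F u := by
    intro u
    simp only [hF, det, Prod.fst_neg, Prod.snd_neg]; ring
  have hd : det (A 0) (B 0) * det (A 0) (B 0) = 1 := by rcases h0.cases with h | h <;> simp [h]
  have hpos : ∀ n, 0 < F (A n) ∧ 0 < F (B n) := by
    intro n
    induction n with
    | zero =>
      have hs : ∀ u : ℤ × ℤ, det u u = 0 := fun u => by simp only [det]; ring
      rw [hF, hF, hs, hs, add_zero, zero_add, hd]
      exact ⟨one_pos, one_pos⟩
    | succ n ih =>
      rcases hstep n with ⟨h1, h2⟩ | ⟨h1, h2⟩ <;> rw [h1, h2, hadd] <;> omega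
  have hmono : StrictMono fun n => F (A n + B n) := by
    refine strictMono_nat_of_lt_succ fun n => ?_
    have := hpos n
    rcases hstep n with ⟨h1, h2⟩ | ⟨h1, h2⟩ <;> rw [h1, h2] <;> simp only [hadd] <;> omega
  refine reg_injective_of_ne_neg (f := fun n => A n + B n)
    (fun n => (unimod_path h0 hstep n).add_right.isCoprime) (fun i j hij => ?_) fun i j hij => ?_
  · have h1 := hpos i
    have h2 := hpos j
    have h3 := hadd (A i) (B i)
    rw [hij, hneg, hadd] at h3
    omega
  · exact hmono.injective (congrArg F hij)

end Path

/-! ### The two exponential bounds for Markoff maps -/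

/-- The lower Fibonacci bound on a cone. -/
lemma hasLinearLowerBound_of_BQ {C : Region → Fin 3} (hC : IsTricoloring C) {p q r s : ℂ} {m : ℝ}
    (hm : p = 0 ∧ q = 0 ∧ r = 0 ∧ s = 4 → 2 < m) {φ : Region → ℂ} (hφ : IsMarkoffMap C p q r s φ)
    (hBQ : SatisfiesBQ (bqConstant p q r s m) φ) {P Q : ℤ × ℤ} (hPQ : Unimod P Q) :
    HasLinearLowerBound (fun u => Real.posLog ‖φ (reg u)‖) P Q := by
  have H := hφ.isLatticeMarkoff hC
  have hα := norm_le_two_mul_alpha p q r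
  have hα0 := alpha_nonneg p q r
  set L := bqConstant p q r s m with hL
  have hL1 : 2 + alpha p q r ≤ L := le_max_left _ _
  have hL2 : m ≤ L := (le_max_left _ _).trans (le_max_right _ _)
  have hL3 : centreBound p q r s + 1 ≤ L := (le_max_right _ _).trans (le_max_right _ _)
  have hfan : ∀ {X Y : ℤ × ℤ}, Unimod X Y → ∃ N : ℕ, ∀ n : ℕ, N ≤ n →
      HasLinearLowerBound (fun u => Real.posLog ‖φ (reg u)‖) X (Y + (n : ℤ) • X) := by
    intro X Y h
    obtain ⟨ρ, c, hρ, hc, hev⟩ := H.eventually_pow_le_norm hBQ.bq1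
      (hBQ.bq2.subset fun X hX => le_trans hX hL3) h
    exact H.exists_hasLinearLowerBound_fan hα hα0 h hρ hc hev
  by_contra hnot
  obtain ⟨A, B, hA0, hB0, hbad, hstep⟩ := HasLinearLowerBound.exists_path hnot
  have h0 : Unimod (A 0) (B 0) := by rwa [hA0, hB0]
  have hu := unimod_path h0 hstep
  -- Otherwise the path eventually turns around the fixed region `B K`, and the fan estimate makes
  -- one of its cones good.
  have hfl : ∃ᶠ n in atTop, A (n + 1) = A n ∧ B (n + 1) = A n + B n := by
    intro hev
    obtain ⟨K, hK⟩ := eventually_atTop.1 hev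
    have hpath : ∀ n : ℕ, A (K + n) = A K + (n : ℤ) • B K ∧ B (K + n) = B K := by
      intro n
      induction n with
      | zero => simp
      | succ n ih =>
        obtain ⟨h1, h2⟩ := (hstep (K + n)).resolve_left (hK (K + n) (by omega))
        rw [← add_assoc, h1, h2, ih.1, ih.2]
        refine ⟨?_, rfl⟩
        push_cast
        rw [add_smul, one_smul, add_assoc]
    obtain ⟨N, hN⟩ := hfan (hu K).symm
    refine hbad (K + N) ?_
    rw [(hpath N).1, (hpath N).2]
    exact (hN N le_rfl).symm
  have hfr : ∃ᶠ n in atTop, A (n + 1) = A n + B n ∧ B (n + 1) = B n := by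
    intro hev
    obtain ⟨K, hK⟩ := eventually_atTop.1 hev
    have hpath : ∀ n : ℕ, A (K + n) = A K ∧ B (K + n) = B K + (n : ℤ) • A K := by
      intro n
      induction n with
      | zero => simp
      | succ n ih =>
        obtain ⟨h1, h2⟩ := (hstep (K + n)).resolve_right (hK (K + n) (by omega))
        rw [← add_assoc, h1, h2, ih.1, ih.2]
        refine ⟨rfl, ?_⟩
        push_cast
        rw [add_smul, one_smul]
        abel
    obtain ⟨N, hN⟩ := hfan (hu K)
    refine hbad (K + N) ?_
    rw [(hpath N).1, (hpath N).2]
    exact hN N le_rfl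
  -- eventually the path only meets regions with large values
  obtain ⟨K, hK⟩ : ∃ K, ∀ n, K ≤ n → L < ‖φ (reg (A n + B n))‖ := by
    have hfin : {n | ‖φ (reg (A n + B n))‖ ≤ L}.Finite :=
      hBQ.bq2.preimage (reg_add_path_injective h0 hstep).injOn
    obtain ⟨K, hK⟩ := hfin.bddAbove
    refine ⟨K + 1, fun n hn => ?_⟩
    by_contra! h
    have := hK (show n ∈ {n | ‖φ (reg (A n + B n))‖ ≤ L} from h)
    omega
  -- Only mediants met after `K` are known to be large; `A n` is one of them once it has been
  -- replaced after that time.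
  have hA : ∃ N, K ≤ N ∧ ∀ n, N ≤ n → L < ‖φ (reg (A n))‖ := by
    obtain ⟨N, hN, h1, -⟩ := (frequently_atTop.1 hfr) K
    refine ⟨N + 1, by omega, fun n hn => ?_⟩
    induction n, hn using Nat.le_induction with
    | base => rw [h1]; exact hK N hN
    | succ n hn ih =>
      rcases hstep n with ⟨h, -⟩ | ⟨h, -⟩ <;> rw [h]
      exacts [ih, hK n (by omega)]
  have hB : ∃ N, K ≤ N ∧ ∀ n, N ≤ n → L < ‖φ (reg (B n))‖ := by
    obtain ⟨N, hN, -, h1⟩ := (frequently_atTop.1 hfl) K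
    refine ⟨N + 1, by omega, fun n hn => ?_⟩
    induction n, hn using Nat.le_induction with
    | base => rw [h1]; exact hK N hN
    | succ n hn ih =>
      rcases hstep n with ⟨-, h⟩ | ⟨-, h⟩ <;> rw [h]
      exacts [hK n (by omega), ih]
  obtain ⟨N₁, hN₁, hA⟩ := hA
  obtain ⟨N₂, hN₂, hB⟩ := hB
  have hshift : ∀ {l : ℕ → Prop}, (∃ᶠ n in atTop, l n) → ∀ N, ∃ᶠ n in atTop, l (N + n) := by
    intro l hl N
    rw [frequently_atTop] at hl ⊢
    intro a
    obtain ⟨b, hb, hlb⟩ := hl (N + a)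
    exact ⟨b - N, by omega, by rwa [Nat.add_sub_cancel' (by omega)]⟩
  set N := N₁ + N₂
  obtain ⟨hzero, hs, htend⟩ := H.eq_four_of_descent hα hα0 (P := fun n => A (N + n))
    (Q := fun n => B (N + n)) (fun n => hu _)
    (l := fun n => A (N + n + 1) = A (N + n) ∧ B (N + n + 1) = A (N + n) + B (N + n))
    (r := fun n => A (N + n + 1) = A (N + n) + B (N + n) ∧ B (N + n + 1) = B (N + n))
    (fun n => hstep _) (fun n hn => hn) (fun n hn => hn) (hshift hfl N) (hshift hfr N)
    (fun n => hL1.trans (hA _ (by omega)).le) (fun n => hL1.trans (hB _ (by omega)).le)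
    (fun n => by
      by_contra! hlt
      exact hbad (N + n) (H.hasLinearLowerBound_of_outward hα hα0 (hu _)
        (hL1.trans_lt (hA _ (by omega))) (hL1.trans_lt (hB _ (by omega))) hlt.le))
  have hp : ∀ i, ![p, q, r] i = 0 := fun i => norm_le_zero_iff.1 (by simpa [hzero] using hα i)
  have h2m := hm ⟨hp 0, hp 1, hp 2, hs⟩
  have : L ≤ 2 := ge_of_tendsto' htend fun n => (hA _ (by omega)).le
  linarith

/-- The norm is additive on each closed quadrant, so the cone bound applies with `F` linear. The
constant `E` dominates `18 * α` and three times the values at the initial vectors of both cones. -/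
lemma exists_norm_le_exp {C : Region → Fin 3} (hC : IsTricoloring C) {p q r s : ℂ}
    {φ : Region → ℂ} (hφ : IsMarkoffMap C p q r s φ) :
    ∃ c : ℝ, 0 < c ∧ ∀ X, ‖φ X‖ ≤ Real.exp (c * norm₁ (vec X)) := by
  have H := hφ.isLatticeMarkoff hC
  have hα := norm_le_two_mul_alpha p q r
  have hα0 := alpha_nonneg p q r
  obtain ⟨E, hE⟩ : ∃ E : ℝ, E = 3 + 18 * alpha p q r + 3 * (‖φ (reg (1, 0))‖ + ‖φ (reg (0, 1))‖ +
    ‖φ (reg (1, 1))‖ + ‖φ (reg (-1, 1))‖) := ⟨_, rfl⟩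
  have n1 := norm_nonneg (φ (reg (1, 0)))
  have n2 := norm_nonneg (φ (reg (0, 1)))
  have n3 := norm_nonneg (φ (reg (1, 1)))
  have n4 := norm_nonneg (φ (reg (-1, 1)))
  have hE3 : 3 ≤ E := by linarith
  have hexp : Real.exp (Real.log E) = E := Real.exp_log (by linarith)
  have hlog : 0 < Real.log E := Real.log_pos (by linarith)
  have hE2 : E / 3 ≤ Real.exp (Real.log E * 2) / 3 := by
    rw [mul_two, Real.exp_add, hexp]
    gcongr
    nlinarith
  have hE1 : E / 3 ≤ Real.exp (Real.log E * 1) / 3 := by rw [mul_one, hexp]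
  have e10 : reg (-1, 0) = reg (1, 0) := by
    rw [← reg_neg]; rfl
  refine ⟨Real.log E, hlog, fun X => ?_⟩
  have finish : ∀ F : ℝ, F ≤ norm₁ (vec X) → ‖φ (reg (vec X))‖ ≤ Real.exp (Real.log E * F) / 3 →
      ‖φ X‖ ≤ Real.exp (Real.log E * norm₁ (vec X)) := by
    intro F hF h
    rw [reg_vec] at h
    have h1 : Real.exp (Real.log E * F) ≤ Real.exp (Real.log E * norm₁ (vec X)) := by gcongr
    have h2 := Real.exp_pos (Real.log E * F)
    linarith
  rcases cone_vec X with h | h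
  · refine finish ((vec X).1 + (vec X).2) (add_le_add (le_abs_self _) (le_abs_self _)) ?_
    refine H.norm_le_exp hα (F := fun u => (u.1 : ℝ) + u.2) (fun u v => ?_) (by linarith)
      (by linarith) h (by simp [Unimod, det]) ?_ ?_ ?_ ?_ ?_
    · push_cast [Prod.fst_add, Prod.snd_add]; ring
    · norm_num
    · norm_num
    · norm_num
      linarith
    · norm_num
      linarith
    · norm_num
      linarith
  · refine finish (-(vec X).1 + (vec X).2) (add_le_add (neg_le_abs _) (le_abs_self _)) ?_
    refine H.norm_le_exp hα (F := fun u => -(u.1 : ℝ) + u.2) (fun u v => ?_) (by linarith)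
      (by linarith) h (by simp [Unimod, det]) ?_ ?_ ?_ ?_ ?_
    · push_cast [Prod.fst_add, Prod.snd_add]; ring
    · norm_num
    · norm_num
    · norm_num
      linarith
    · rw [e10]
      norm_num
      linarith
    · norm_num
      linarith

end MarkoffFarey

theorem theorem4 (C : MarkoffFarey.Region → Fin 3) (hC : MarkoffFarey.IsTricoloring C)
    (p q r s : ℂ) (m : ℝ) (hm : p = 0 ∧ q = 0 ∧ r = 0 ∧ s = 4 → 2 < m)
    (φ : MarkoffFarey.Region → ℂ) (hφ : MarkoffFarey.IsMarkoffMap C p q r s φ)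
    (hBQ : MarkoffFarey.SatisfiesBQ (MarkoffFarey.bqConstant p q r s m) φ) :
    MarkoffFarey.HasFibonacciGrowth (fun X => Real.posLog ‖φ X‖) := by
  open MarkoffFarey in
  refine ⟨fun e => ?_, fun e => ?_⟩
  · obtain ⟨K, hK, h1, -⟩ := exists_fib_bounds e
    obtain ⟨c, hc, h⟩ := exists_norm_le_exp hC hφ
    refine ⟨c * K, by positivity, fun X _ => ?_⟩
    rw [mul_assoc]
    refine le_trans ?_ (mul_le_mul_of_nonneg_left (h1 X) hc.le)
    rw [Real.posLog_def]
    have hn : 0 ≤ c * norm₁ (vec X) := mul_nonneg hc.le (norm₁_nonneg _)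
    refine max_le hn ?_
    rcases (norm_nonneg (φ X)).eq_or_lt with h0 | h0
    · simpa [← h0] using hn
    · exact (Real.log_le_iff_le_exp h0).2 (h X)
  · obtain ⟨K, hK, -, h2⟩ := exists_fib_bounds e
    obtain ⟨c, hc, hf⟩ := hasLinearLowerBound_of_BQ hC hm hφ hBQ
      (show Unimod (1, 0) (0, 1) by simp [Unimod, det])
    obtain ⟨c', hc', hf'⟩ := hasLinearLowerBound_of_BQ hC hm hφ hBQ
      (show Unimod (0, 1) (-1, 0) by simp [Unimod, det])
    refine ⟨min c c' / K, by positivity,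
      ((hf.union hf').preimage vec_injective.injOn).subset ?_⟩
    rintro X ⟨-, hX⟩
    have hle : min c c' / K * fib e X ≤ min c c' * norm₁ (vec X) := by
      rw [div_mul_eq_mul_div, div_le_iff₀ hK, mul_assoc, mul_comm _ K]
      exact mul_le_mul_of_nonneg_left (h2 X) (by positivity)
    rcases cone_vec X with hcone | hcone
    · refine Or.inl ⟨hcone, fun hn => hX (hle.trans ?_)⟩
      simp only [reg_vec] at hn
      exact (mul_le_mul_of_nonneg_right (min_le_left _ _) (norm₁_nonneg _)).trans hn
    · refine Or.inr ⟨hcone, fun hn => hX (hle.trans ?_)⟩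
      simp only [reg_vec] at hn
      exact (mul_le_mul_of_nonneg_right (min_le_right _ _) (norm₁_nonneg _)).trans hn
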